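/- Fix the following model. Algorithms are deterministic programs for a random access machine with registers and an indirectly addressed memory. In unit time it loads a constant, performs an arithmetic or bitwise operation, reads or writes a memory cell, or performs a conditional jump; every register and memory cell holds a non-negative integer of at most $w$ bits, where $w=O(\log m)$ for inputs that are graphs with $m$ edges and $w=O(n+\log L)$ for inputs that are CNF formulas with $n$ variables and (encoded) length $L$. A graph is given as a list of its edges, and a formula as a list of its clauses. For $c\ge 1$, a $c$-approximation algorithm for the diameter $D$ of a graph outputs an integer $\hat D$ with $D/c\le \hat D\le D$. The notation $O^*(f(n))$ hides a factor polynomial in $n$ and in the length of the formula. Let $$s_r=\inf\{\delta\ge 0 : r\text{-SAT on } n \text{ variables is solvable in } O^*(2^{\delta n}) \text{ time}\},$$ where $r$-SAT is the satisfiability problem for CNF formulas with at most $r$ literals per clause. The Strong Exponential Time Hypothesis (SETH) asserts that $\lim_{r\to\infty}s_r=1$. **Theorem.** Suppose that for some constant $\varepsilon$ with $0<\varepsilon\le 1/2$ there is a $(3/2-\varepsilon)$-approximation algorithm for the diameter of connected undirected unweighted (simple) graphs that runs in $O(m^{2-\varepsilon})$ time on graphs with $m$ edges, for every $m\ge 1$.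 Then there is a constant $\delta$ with $0<\delta<1$ such that satisfiability of CNF formulas on $n$ variables can be solved in $O^*((2-\delta)^n)$ time. Moreover, SETH is false. -/

import Mathlib

open Filter Topology

/-! ### A random access machine with a step count and a word length -/

namespace RAM

/-- The arithmetic and bitwise operations of the machine. -/
inductive Op
  | add | sub | mul | div | mod | and | or | xor | shl | shr

/-- The operations act on natural numbers. Subtraction is truncated at `0`, and division and
remainder by `0` follow the conventions `a / 0 = 0` and `a % 0 = a`. -/
def Op.eval : Op → ℕ → ℕ → ℕ
  | .add, a, b => a + b
  | .sub, a, b => a - b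
  | .mul, a, b => a * b
  | .div, a, b => a / b
  | .mod, a, b => a % b
  | .and, a, b => a &&& b
  | .or, a, b => a ||| b
  | .xor, a, b => a ^^^ b
  | .shl, a, b => a <<< b
  | .shr, a, b => a >>> b

/-- The instructions. The natural numbers `d`, `a`, `b` name registers. -/
inductive Instr
  /-- `reg d := k` -/
  | const (d k : ℕ)
  /-- `reg d := o (reg a) (reg b)` -/
  | op (o : Op) (d a b : ℕ)
  /-- `reg d := mem (reg a)` -/
  | load (d a : ℕ)
  /-- `mem (reg a) := reg b` -/
  | store (a b : ℕ)
  /-- jump to the instruction number `t` if `reg a < reg b` -/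
  | jlt (a b t : ℕ)
  /-- jump to the instruction number `t` if `reg a = reg b` -/
  | jeq (a b t : ℕ)

/-- A program is a finite list of instructions, numbered from `0`. -/
abbrev Program := List Instr

/-- A configuration: program counter, registers and memory. -/
structure State where
  pc : ℕ
  reg : ℕ → ℕ
  mem : ℕ → ℕ

/-- The effect of a single instruction. -/
def Instr.exec (s : State) : Instr → State
  | .const d k => ⟨s.pc + 1, Function.update s.reg d k, s.mem⟩
  | .op o d a b => ⟨s.pc + 1, Function.update s.reg d (o.eval (s.reg a) (s.reg b)), s.mem⟩
  | .load d a => ⟨s.pc + 1, Function.update s.reg d (s.mem (s.reg a)), s.mem⟩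
  | .store a b => ⟨s.pc + 1, s.reg, Function.update s.mem (s.reg a) (s.reg b)⟩
  | .jlt a b t => ⟨if s.reg a < s.reg b then t else s.pc + 1, s.reg, s.mem⟩
  | .jeq a b t => ⟨if s.reg a = s.reg b then t else s.pc + 1, s.reg, s.mem⟩

/-- One step of the program `P`. When the program counter has left the program the machine has
halted, and the configuration does not change any more. -/
def Program.step (P : Program) (s : State) : State :=
  match P[s.pc]? with
  | none => s
  | some i => i.exec s

/-- The initial configuration: the input words stand in the memory cells `0, 1, 2, …`; every other
cell and every register holds `0`. -/
def init (x : List ℕ) : State := ⟨0, fun _ => 0, fun i => x.getD i 0⟩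

/-- The configuration of `P` on the input `x` after `t` steps. -/
def Program.run (P : Program) (x : List ℕ) (t : ℕ) : State := P.step^[t] (init x)

/-- All registers and all memory cells hold words of `w` bits. -/
def State.Fits (s : State) (w : ℕ) : Prop :=
  (∀ i, s.reg i < 2 ^ w) ∧ ∀ i, s.mem i < 2 ^ w

/-- Started on the input `x`, the program `P` halts after at most `T` steps with the word `y` in
register `0`, and up to then it only uses words of `w` bits. -/
def Program.Outputs (P : Program) (x : List ℕ) (y : ℕ) (T : ℝ) (w : ℕ) : Prop :=
  ∃ t : ℕ, (t : ℝ) ≤ T ∧ P.length ≤ (P.run x t).pc ∧ (P.run x t).reg 0 = y ∧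
    ∀ i ≤ t, (P.run x i).Fits w

end RAM

/-! ### Approximating the diameter -/

/-- `l` lists every edge of `G` exactly once, in any order and with the two endpoints of each edge
in any order. -/
def SimpleGraph.IsEdgeListing {N : ℕ} (G : SimpleGraph (Fin N)) (l : List (Fin N × Fin N)) :
    Prop :=
  (l.map fun p => s(p.1, p.2)).Nodup ∧ ∀ e : Sym2 (Fin N), e ∈ l.map (fun p => s(p.1, p.2)) ↔
    e ∈ G.edgeSet

/-- A graph with `N` vertices and edges `u₁v₁, …, uₘvₘ` is given to the machine as the word
sequence `N, m, u₁, v₁, …, uₘ, vₘ`. -/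
def encodeGraph (N : ℕ) (l : List (Fin N × Fin N)) : List ℕ :=
  N :: l.length :: l.flatMap fun p => [(p.1 : ℕ), (p.2 : ℕ)]

/-- There is an `α`-approximation algorithm for the diameter of connected undirected unweighted
graphs that runs in time `O(f(m))` on graphs with `m ≥ 1` edges: it computes an estimate `E` with
`D / α ≤ E ≤ D`, where `D` is the diameter. The algorithm is a single program for the random access
machine, working with words of `O(log m)` bits (`Nat.size m` is the number of bits of `m`). -/
def DiameterApproxInTime (α : ℝ) (f : ℕ → ℝ) : Prop :=
  ∃ (P : RAM.Program) (C c : ℕ), ∀ (N : ℕ) (G : SimpleGraph (Fin N)) (l : List (Fin N × Fin N)),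
    G.Connected → G.IsEdgeListing l → 1 ≤ l.length →
      ∃ E : ℕ, P.Outputs (encodeGraph N l) E (C * f l.length) (c * Nat.size l.length) ∧
        (G.diam : ℝ) / α ≤ E ∧ E ≤ G.diam

/-! ### Satisfiability and the Strong Exponential Time Hypothesis -/

/-- A literal over the variables `0, …, n - 1`: `(v, true)` is the variable `v`, and `(v, false)` is
its negation. -/
abbrev Lit (n : ℕ) := Fin n × Bool

/-- A formula in conjunctive normal form over `n` variables: a list of clauses, each of which is a
list of literals. -/
abbrev CNF (n : ℕ) := List (List (Lit n))

/-- Some truth assignment satisfies a literal in every clause. -/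
def CNF.Satisfiable {n : ℕ} (F : CNF n) : Prop :=
  ∃ a : Fin n → Bool, ∀ K ∈ F, ∃ x ∈ K, a x.1 = x.2

/-- Every clause has at most `r` literals. -/
def CNF.WidthLE {n : ℕ} (r : ℕ) (F : CNF n) : Prop := ∀ K ∈ F, K.length ≤ r

/-- The word that stands for a literal: `2 v + 1` for the variable `v` and `2 v` for its negation. -/
def Lit.code {n : ℕ} (x : Lit n) : ℕ := 2 * (x.1 : ℕ) + x.2.toNat

/-- A formula is given to the machine as the number of variables, the number of clauses, and then,
clause by clause, the number of literals of the clause followed by these literals. -/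
def CNF.encode {n : ℕ} (F : CNF n) : List ℕ :=
  n :: F.length :: F.flatMap fun K => K.length :: K.map Lit.code

open Classical in
/-- Satisfiability of the formulas `F` with `A F` is decidable in time `O*(β ^ n)`, where `n` is the
number of variables and `O*` hides a factor that is polynomial in `n` and the length of the formula.
The algorithm is a single program for the random access machine, working with words of
`O(n + log L)` bits, where `L` is the length of the input; it answers `1` or `0`. -/
def SatInTime (A : ∀ n : ℕ, CNF n → Prop) (β : ℝ) : Prop :=
  ∃ (P : RAM.Program) (C k c : ℕ), ∀ (n : ℕ) (F : CNF n), A n F →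
    P.Outputs F.encode (if F.Satisfiable then 1 else 0)
      (C * β ^ n * ((n + F.encode.length : ℕ) : ℝ) ^ k) (c * (n + Nat.size F.encode.length))

/-- CNF-SAT is solvable in time `O*(β ^ n)`. -/
def CnfSatInTime (β : ℝ) : Prop := SatInTime (fun _ _ => True) β

/-- The exponent `s_r`: the infimum of the `δ ≥ 0` such that `r`-SAT is solvable in time
`O*(2 ^ (δ n))`. -/
noncomputable def satExponent (r : ℕ) : ℝ :=
  sInf {δ : ℝ | 0 ≤ δ ∧ SatInTime (fun _ F => F.WidthLE r) ((2 : ℝ) ^ δ)}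

/-- The Strong Exponential Time Hypothesis: `s_r` tends to `1` as `r` tends to infinity. -/
def SETH : Prop := Tendsto satExponent atTop (𝓝 1)

/-! Split the n variables into two halves of h = ⌈n/2⌉ positions and make a vertex for each of the
2·2^h half assignments. Each one is joined to the clauses that it does not satisfy and to the hub of
its side; the two hubs are joined to each other and to all clauses. Any two vertices are within
distance 2 through a hub, except possibly two half assignments of opposite sides. A common neighbour
of such a pair can only be a clause that both miss, so the distance is at least 3 exactly when the
pair together satisfies the formula. Hence the diameter is at least 3 if the formula is satisfiable
and at most 2 otherwise (`HalfGraph.exists_graph`, `HalfGraph.halvesSatisfy_iff`), and an estimate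
within a factor below 3/2 exceeds 2 in the first case only.

The graph has at most 4·B·2^h edges, where B is the length of the formula, so time m^(2-ε) becomes
2^((1-ε/2)n) up to a polynomial factor (`HalfGraph.time_bound`). This exponent does not depend on
the clause width, so every s_r is at most 1 - ε/2, which contradicts SETH.

Since algorithms are concrete machine programs, the reduction is one as well. A timed Hoare logic
for structured commands (`RAM.Cmd.Ach`) verifies the code that writes the graph behind the formula
(`HalfGraph.writeGraph_spec`). The given program then runs with displaced registers and memory, two
instructions for each of its own (`RAM.Shifted.run`), and its answer is compared with 2. Every step
also carries the proof that words stay within the permitted length (`HalfGraph.word_bounds`). -/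

namespace RAM

/-! ### Stores and runs with step counts and word bounds -/

/-- The registers and the memory of the machine, without the program counter. -/
structure Store where
  reg : ℕ → ℕ
  mem : ℕ → ℕ

namespace Store

/-- The configuration with a given program counter. -/
def withPc (σ : Store) (pc : ℕ) : State := ⟨pc, σ.reg, σ.mem⟩

/-- Write a register. -/
def set (σ : Store) (d v : ℕ) : Store := ⟨Function.update σ.reg d v, σ.mem⟩

/-- Write a memory cell. -/
def poke (σ : Store) (a v : ℕ) : Store := ⟨σ.reg, Function.update σ.mem a v⟩

/-- All registers and memory cells hold words of `w` bits. -/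
def Fits (σ : Store) (w : ℕ) : Prop := (∀ i, σ.reg i < 2 ^ w) ∧ ∀ i, σ.mem i < 2 ^ w

@[simp] theorem set_mem (σ : Store) (d v : ℕ) : (σ.set d v).mem = σ.mem := rfl
@[simp] theorem poke_reg (σ : Store) (d v : ℕ) : (σ.poke d v).reg = σ.reg := rfl
theorem set_reg (σ : Store) (d v r : ℕ) :
    (σ.set d v).reg r = if r = d then v else σ.reg r := by
  simp [set, Function.update_apply]

theorem poke_mem (σ : Store) (d v : ℕ) : (σ.poke d v).mem = Function.update σ.mem d v := rfl

theorem Fits.set {σ : Store} {w d v : ℕ} (h : σ.Fits w) (hv : v < 2 ^ w) : (σ.set d v).Fits w := by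
  refine ⟨fun i => ?_, h.2⟩
  rw [set_reg]
  split_ifs
  exacts [hv, h.1 i]

theorem Fits.poke {σ : Store} {w d v : ℕ} (h : σ.Fits w) (hv : v < 2 ^ w) :
    (σ.poke d v).Fits w := by
  refine ⟨h.1, fun i => ?_⟩
  rw [poke_mem, Function.update_apply]
  split_ifs
  exacts [hv, h.2 i]

end Store

/-- The program `P` goes from `s` to `s'` in `t` steps, using only words of `w` bits. -/
def Reach (P : Program) (w : ℕ) (s s' : State) (t : ℕ) : Prop :=
  P.step^[t] s = s' ∧ ∀ i ≤ t, (P.step^[i] s).Fits w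

theorem Reach.refl {P : Program} {w : ℕ} {s : State} (h : s.Fits w) : Reach P w s s 0 :=
  ⟨rfl, fun i hi => by obtain rfl : i = 0 := by omega
                       exact h⟩

theorem Reach.fits_right {P : Program} {w t : ℕ} {s s' : State} (h : Reach P w s s' t) :
    s'.Fits w := by
  have := h.2 t le_rfl
  rwa [h.1] at this

theorem Reach.trans {P : Program} {w t t' : ℕ} {s s' s'' : State} (h : Reach P w s s' t)
    (h' : Reach P w s' s'' t') : Reach P w s s'' (t + t') := by
  constructor
  · rw [Nat.add_comm, Function.iterate_add_apply, h.1, h'.1]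
  · intro i hi
    rcases le_total i t with hit | hit
    · exact h.2 i hit
    · obtain ⟨j, rfl⟩ := Nat.exists_eq_add_of_le hit
      rw [Nat.add_comm, Function.iterate_add_apply, h.1]
      exact h'.2 j (by omega)

theorem Reach.single {P : Program} {w pc pc' : ℕ} {σ σ' : Store} {i : Instr}
    (hi : P[pc]? = some i) (hs : i.exec (σ.withPc pc) = σ'.withPc pc') (h : σ.Fits w)
    (h' : σ'.Fits w) : Reach P w (σ.withPc pc) (σ'.withPc pc') 1 := by
  have hst : P.step (σ.withPc pc) = σ'.withPc pc' := by
    rw [← hs, Program.step, show P[(σ.withPc pc).pc]? = some i from hi]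
  refine ⟨by simpa using hst, fun j hj => ?_⟩
  interval_cases j
  · exact h
  · rw [Function.iterate_one, hst]
    exact h'

/-- The instructions `c` stand in the program `P` from number `o` on. -/
def CodeAt (P : Program) : ℕ → List Instr → Prop
  | _, [] => True
  | o, i :: c => P[o]? = some i ∧ CodeAt P (o + 1) c

theorem codeAt_append {P : Program} {c d : List Instr} {o : ℕ} :
    CodeAt P o (c ++ d) ↔ CodeAt P o c ∧ CodeAt P (o + c.length) d := by
  induction c generalizing o with
  | nil => simp [CodeAt]
  | cons i c ih =>
    simp only [List.cons_append, CodeAt, ih, List.length_cons, and_assoc]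
    rw [show o + 1 + c.length = o + (c.length + 1) by omega]

theorem codeAt_append_left (p c : List Instr) : CodeAt (p ++ c) p.length c := by
  induction c generalizing p with
  | nil => trivial
  | cons i c ih => exact ⟨by simp, by simpa using ih (p ++ [i])⟩

/-! ### Structured commands, compilation and a timed Hoare logic -/

/-- Structured programs. -/
inductive Cmd
  | const (d k : ℕ)
  | op (o : Op) (d a b : ℕ)
  | load (d a : ℕ)
  | store (a b : ℕ)
  | seq (c c' : Cmd)
  | whileLt (a b : ℕ) (c : Cmd)
  | ifEq (a b : ℕ) (c : Cmd)

namespace Cmd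

infixr:60 " ;; " => Cmd.seq

/-- The number of instructions of the compiled program. -/
def size : Cmd → ℕ
  | const _ _ | op _ _ _ _ | load _ _ | store _ _ => 1
  | seq c c' => c.size + c'.size
  | whileLt _ _ c => c.size + 3
  | ifEq _ _ c => c.size + 2

/-- The machine code, to be placed from the instruction number `o` on. -/
def compile : Cmd → ℕ → List Instr
  | const d k, _ => [.const d k]
  | op f d a b, _ => [.op f d a b]
  | load d a, _ => [.load d a]
  | store a b, _ => [.store a b]
  | seq c c', o => c.compile o ++ c'.compile (o + c.size)
  -- `jeq 0 0` compares a register with itself and so jumps unconditionally; the conditional jump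
  -- before it skips this exit.
  | whileLt a b c, o => .jlt a b (o + 2) :: .jeq 0 0 (o + (c.size + 3)) ::
      (c.compile (o + 2) ++ [.jeq 0 0 o])
  | ifEq a b c, o => .jeq a b (o + 2) :: .jeq 0 0 (o + (c.size + 2)) :: c.compile (o + 2)

theorem length_compile (c : Cmd) (o : ℕ) : (c.compile o).length = c.size := by
  induction c generalizing o <;> simp_all [compile, size]

/-- Started on `σ`, the command `c` terminates after at most `T` steps in a store that satisfies
`Q`, using only words of `w` bits. -/
def Ach (w : ℕ) (c : Cmd) (σ : Store) (T : ℕ) (Q : Store → Prop) : Prop :=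
  ∀ (P : Program) (o : ℕ), CodeAt P o (c.compile o) → σ.Fits w →
    ∃ t ≤ T, ∃ σ', Q σ' ∧ Reach P w (σ.withPc o) (σ'.withPc (o + c.size)) t

variable {w T T' : ℕ} {c c' : Cmd} {σ : Store} {Q Q' : Store → Prop}

theorem Ach.mono (h : Ach w c σ T Q) (hT : T ≤ T') (hQ : ∀ σ, Q σ → Q' σ) : Ach w c σ T' Q' := by
  intro P o hP hσ
  obtain ⟨t, ht, σ', hσ', hr⟩ := h P o hP hσ
  exact ⟨t, ht.trans hT, σ', hQ _ hσ', hr⟩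

theorem Ach.mono_time (h : Ach w c σ T Q) (hT : T ≤ T') : Ach w c σ T' Q := h.mono hT fun _ => id

theorem Ach.const {d k : ℕ} (hk : k < 2 ^ w) (h : Q (σ.set d k)) : Ach w (.const d k) σ 1 Q :=
  fun _ _ hP hσ => ⟨1, le_rfl, _, h, .single hP.1 rfl hσ (hσ.set hk)⟩

theorem Ach.op {f : Op} {d a b : ℕ} (hk : σ.Fits w → f.eval (σ.reg a) (σ.reg b) < 2 ^ w)
    (h : Q (σ.set d (f.eval (σ.reg a) (σ.reg b)))) : Ach w (.op f d a b) σ 1 Q :=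
  fun _ _ hP hσ => ⟨1, le_rfl, _, h, .single hP.1 rfl hσ (hσ.set (hk hσ))⟩

theorem Ach.op_eq {f : Op} {d a b v : ℕ} (hv : f.eval (σ.reg a) (σ.reg b) = v) (hk : v < 2 ^ w)
    (h : Q (σ.set d v)) : Ach w (.op f d a b) σ 1 Q := by
  subst hv
  exact .op (fun _ => hk) h

theorem Ach.add {d a b : ℕ} (hk : σ.reg a + σ.reg b < 2 ^ w)
    (h : Q (σ.set d (σ.reg a + σ.reg b))) : Ach w (.op .add d a b) σ 1 Q :=
  .op (fun _ => hk) h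

/-- The results of subtraction, division, remainder and right shift never exceed the first operand,
so unlike addition they leave no word bound to prove. -/
theorem Ach.sub {d a b : ℕ} (h : Q (σ.set d (σ.reg a - σ.reg b))) :
    Ach w (.op .sub d a b) σ 1 Q :=
  .op (fun hσ => (Nat.sub_le _ _).trans_lt (hσ.1 a)) h

theorem Ach.div {d a b : ℕ} (h : Q (σ.set d (σ.reg a / σ.reg b))) :
    Ach w (.op .div d a b) σ 1 Q :=
  .op (fun hσ => (Nat.div_le_self _ _).trans_lt (hσ.1 a)) h

theorem Ach.mod {d a b : ℕ} (h : Q (σ.set d (σ.reg a % σ.reg b))) :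
    Ach w (.op .mod d a b) σ 1 Q :=
  .op (fun hσ => (Nat.mod_le _ _).trans_lt (hσ.1 a)) h

theorem Ach.shr {d a b : ℕ} (h : Q (σ.set d (σ.reg a >>> σ.reg b))) :
    Ach w (.op .shr d a b) σ 1 Q :=
  .op (fun hσ => (Nat.shiftRight_le _ _).trans_lt (hσ.1 a)) h

theorem Ach.load {d a : ℕ} (h : Q (σ.set d (σ.mem (σ.reg a)))) : Ach w (.load d a) σ 1 Q :=
  fun _ _ hP hσ => ⟨1, le_rfl, _, h, .single hP.1 rfl hσ (hσ.set (hσ.2 _))⟩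

theorem Ach.store {a b : ℕ} (h : Q (σ.poke (σ.reg a) (σ.reg b))) : Ach w (.store a b) σ 1 Q :=
  fun _ _ hP hσ => ⟨1, le_rfl, _, h, .single hP.1 rfl hσ (hσ.poke (hσ.1 _))⟩

theorem Ach.seq (h : Ach w c σ T fun σ' => Ach w c' σ' T' Q) : Ach w (c ;; c') σ (T' + T) Q := by
  intro P o hP hσ
  simp only [compile, codeAt_append, length_compile] at hP
  obtain ⟨t, ht, σ', hσ', hr⟩ := h P o hP.1 hσ
  obtain ⟨t', ht', σ'', hσ'', hr'⟩ := hσ' P _ hP.2 hr.fits_right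
  exact ⟨t + t', by omega, σ'', hσ'', by simpa [size, Nat.add_assoc] using hr.trans hr'⟩

theorem Ach.step (h : Ach w c σ 1 fun σ' => Ach w c' σ' T Q) : Ach w (c ;; c') σ (T + 1) Q :=
  .seq h

theorem Ach.ifEq {a b : ℕ} (h : σ.reg a = σ.reg b → Ach w c σ T Q)
    (h' : σ.reg a ≠ σ.reg b → Q σ) : Ach w (.ifEq a b c) σ (T + 2) Q := by
  intro P o hP hσ
  obtain ⟨h1, h2, h3⟩ := hP
  by_cases hab : σ.reg a = σ.reg b
  · obtain ⟨t, ht, σ', hσ', hr⟩ := h hab P _ h3 hσ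
    have h0 : Reach P w (σ.withPc o) (σ.withPc (o + 2)) 1 :=
      .single h1 (by simp [Instr.exec, Store.withPc, hab]) hσ hσ
    refine ⟨1 + t, by omega, σ', hσ', ?_⟩
    simpa [size, Nat.add_assoc, Nat.add_comm 2] using h0.trans hr
  · have h0 : Reach P w (σ.withPc o) (σ.withPc (o + 1)) 1 :=
      .single h1 (by simp [Instr.exec, Store.withPc, hab]) hσ hσ
    have h0' : Reach P w (σ.withPc (o + 1)) (σ.withPc (o + (c.size + 2))) 1 :=
      .single h2 (by simp [Instr.exec, Store.withPc]) hσ hσ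
    exact ⟨1 + 1, by omega, σ, h' hab, h0.trans h0'⟩

/-- The invariant is indexed by the completed rounds and must itself decide the guard, which fixes
the number of rounds at `N`. A round costs two jumps besides the body, and leaving the loop costs
two more. -/
theorem Ach.whileLt {a b N : ℕ} (I : ℕ → Store → Prop)
    (hlt : ∀ k ≤ N, ∀ σ, I k σ → (σ.reg a < σ.reg b ↔ k < N))
    (hc : ∀ k < N, ∀ σ, I k σ → Ach w c σ T (I (k + 1))) (h0 : I 0 σ) :
    Ach w (.whileLt a b c) σ (N * (T + 2) + 2) (I N) := by
  intro P o hP hσ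
  obtain ⟨h1, h2, h3⟩ := hP
  rw [codeAt_append, length_compile] at h3
  obtain ⟨h3, h4, -⟩ := h3
  -- Induction on the number `r` of remaining rounds.
  have main : ∀ r k σ, k + r = N → I k σ → σ.Fits w → ∃ t ≤ r * (T + 2) + 2, ∃ σ', I N σ' ∧
      Reach P w (σ.withPc o) (σ'.withPc (o + (c.size + 3))) t := by
    intro r
    induction r with
    | zero =>
      intro k σ hk hI hσ
      obtain rfl : k = N := hk
      have hlt' : ¬ σ.reg a < σ.reg b := fun h => lt_irrefl _ ((hlt k le_rfl σ hI).1 h)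
      have g1 : Reach P w (σ.withPc o) (σ.withPc (o + 1)) 1 :=
        .single h1 (by simp [Instr.exec, Store.withPc, hlt']) hσ hσ
      have g2 : Reach P w (σ.withPc (o + 1)) (σ.withPc (o + (c.size + 3))) 1 :=
        .single h2 (by simp [Instr.exec, Store.withPc]) hσ hσ
      exact ⟨1 + 1, by omega, σ, hI, g1.trans g2⟩
    | succ r ih =>
      intro k σ hk hI hσ
      have hlt' : σ.reg a < σ.reg b := (hlt k (by omega) σ hI).2 (by omega)
      have g1 : Reach P w (σ.withPc o) (σ.withPc (o + 2)) 1 :=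
        .single h1 (by simp [Instr.exec, Store.withPc, hlt']) hσ hσ
      obtain ⟨t, ht, σ', hI', g2⟩ := hc k (by omega) σ hI P _ h3 hσ
      have g3 : Reach P w (σ'.withPc (o + 2 + c.size)) (σ'.withPc o) 1 :=
        .single h4 (by simp [Instr.exec, Store.withPc]) g2.fits_right g2.fits_right
      obtain ⟨t', ht', σ'', hI'', g4⟩ := ih (k + 1) σ' (by omega) hI' g2.fits_right
      refine ⟨1 + t + 1 + t', ?_, σ'', hI'', ((g1.trans g2).trans g3).trans g4⟩
      rw [Nat.add_mul]
      omega
  exact main N 0 σ (by omega) h0 hσ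

end Cmd

end RAM

/-! ### The words and the edges -/

namespace HalfGraph

/-- The word sequence of a list of clauses, each given by the codes of its literals. -/
def clauseWords (cl : List (List ℕ)) : List ℕ := cl.flatMap fun K => K.length :: K

/-- The word sequence of a formula with `n` variables and clauses `cl`. -/
def formulaWords (n : ℕ) (cl : List (List ℕ)) : List ℕ := n :: cl.length :: clauseWords cl

/-- The address of the clause number `j`. -/
def clausePos (cl : List (List ℕ)) (j : ℕ) : ℕ := 2 + (clauseWords (cl.take j)).length

/-- The half assignment `i` makes the literal with code `x` true. The half assignments of the
variables `0, …, h - 1` are `0, …, 2 ^ h - 1`, those of the variables `h, …, 2 h - 1` are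
`2 ^ h, …, 2 ^ (h + 1) - 1`. -/
def litHolds (h i x : ℕ) : Bool := x / 2 / h = i / 2 ^ h ∧ (i >>> (x / 2 % h)) % 2 = x % 2

/-- The edges between the two hubs `0`, `1` and the first `k` clauses. -/
def hubEdges (k : ℕ) : List (ℕ × ℕ) := (List.range k).flatMap fun j => [(0, j + 2), (1, j + 2)]

/-- The edges between the half assignment `i` and those among the first `k` clauses that it does
not satisfy. -/
def missEdges (h : ℕ) (cl : List (List ℕ)) (i k : ℕ) : List (ℕ × ℕ) :=
  ((List.range k).filter fun j => (cl.getD j []).any (litHolds h i) = false).map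
    fun j => (j + 2, cl.length + 2 + i)

/-- The edges at the first `k` half assignments. -/
def halfEdges (h : ℕ) (cl : List (List ℕ)) (k : ℕ) : List (ℕ × ℕ) :=
  (List.range k).flatMap fun i => (i / 2 ^ h, cl.length + 2 + i) :: missEdges h cl i cl.length

/-- All edges. -/
def allEdges (h : ℕ) (cl : List (List ℕ)) : List (ℕ × ℕ) :=
  (0, 1) :: (hubEdges cl.length ++ halfEdges h cl (2 * 2 ^ h))

/-- The number of vertices. -/
def order (h : ℕ) (cl : List (List ℕ)) : ℕ := 2 * 2 ^ h + (cl.length + 2)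

/-- The word sequence of a list of edges. -/
def edgeWords (E : List (ℕ × ℕ)) : List ℕ := E.flatMap fun p => [p.1, p.2]

variable {n h i j k : ℕ} {cl : List (List ℕ)}

@[simp] theorem edgeWords_append (E E' : List (ℕ × ℕ)) :
    edgeWords (E ++ E') = edgeWords E ++ edgeWords E' := by simp [edgeWords]

@[simp] theorem length_edgeWords (E : List (ℕ × ℕ)) : (edgeWords E).length = 2 * E.length := by
  induction E with
  | nil => rfl
  | cons a E ih => simp_all [edgeWords]; omega

theorem hubEdges_succ : hubEdges (k + 1) = hubEdges k ++ [(0, k + 2), (1, k + 2)] := by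
  simp [hubEdges, List.range_succ]

theorem halfEdges_succ : halfEdges h cl (k + 1) =
    halfEdges h cl k ++ (k / 2 ^ h, cl.length + 2 + k) :: missEdges h cl k cl.length := by
  simp [halfEdges, List.range_succ]

theorem missEdges_succ_of_true (hk : (cl.getD k []).any (litHolds h i) = true) :
    missEdges h cl i (k + 1) = missEdges h cl i k := by
  simp only [missEdges, List.range_succ, List.filter_append, List.map_append, List.filter_cons, hk]
  simp

theorem missEdges_succ_of_false (hk : (cl.getD k []).any (litHolds h i) = false) :
    missEdges h cl i (k + 1) = missEdges h cl i k ++ [(k + 2, cl.length + 2 + i)] := by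
  simp only [missEdges, List.range_succ, List.filter_append, List.map_append, List.filter_cons, hk]
  simp

theorem length_hubEdges : (hubEdges k).length = 2 * k := by
  induction k with
  | zero => rfl
  | succ k ih => rw [hubEdges_succ, List.length_append, ih]; rfl

theorem length_missEdges_le : (missEdges h cl i k).length ≤ k := by
  rw [missEdges, List.length_map]
  exact (List.length_filter_le _ _).trans_eq List.length_range

theorem length_halfEdges_le : (halfEdges h cl k).length ≤ k * (cl.length + 1) := by
  induction k with
  | zero => simp [halfEdges]
  | succ k ih =>
    have := length_missEdges_le (h := h) (cl := cl) (i := k) (k := cl.length)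
    rw [halfEdges_succ, List.length_append, List.length_cons, Nat.add_mul]
    omega

theorem length_allEdges_le :
    (allEdges h cl).length ≤ 1 + 2 * cl.length + 2 * 2 ^ h * (cl.length + 1) := by
  have := length_halfEdges_le (h := h) (cl := cl) (k := 2 * 2 ^ h)
  simp only [allEdges, List.length_cons, List.length_append, length_hubEdges]
  omega

/-! ### Locating clauses and literals in the encoded formula -/

theorem formulaWords_eq (hj : j < cl.length) : ∃ p s : List ℕ, p.length = clausePos cl j ∧
    formulaWords n cl = p ++ ((cl.getD j []).length :: cl.getD j []) ++ s := by
  refine ⟨n :: cl.length :: clauseWords (cl.take j), clauseWords (cl.drop (j + 1)), ?_, ?_⟩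
  · simp [clausePos]; omega
  · have : cl = cl.take j ++ (cl.getD j [] :: cl.drop (j + 1)) := by
      rw [List.getD_eq_getElem _ _ hj, ← List.drop_eq_getElem_cons, List.take_append_drop]
    conv_lhs => rw [formulaWords, clauseWords, this]
    simp [clauseWords]
    omega

theorem getD_clausePos (hj : j < cl.length) :
    (formulaWords n cl).getD (clausePos cl j) 0 = (cl.getD j []).length := by
  obtain ⟨p, s, hp, h⟩ := formulaWords_eq (n := n) hj
  rw [h, ← hp]
  simp [List.getD_eq_getElem?_getD]

theorem getD_clausePos_add (hj : j < cl.length) (hk : k < (cl.getD j []).length) :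
    (formulaWords n cl).getD (clausePos cl j + 1 + k) 0 = (cl.getD j []).getD k 0 := by
  obtain ⟨p, s, hp, h⟩ := formulaWords_eq (n := n) hj
  rw [h, ← hp, Nat.add_assoc, List.append_assoc]
  generalize cl.getD j [] = K at *
  rw [List.getD_append_right _ _ _ _ (by omega), Nat.add_sub_cancel_left, Nat.add_comm 1 k,
    List.getD_append _ _ _ _ (by simpa using hk), List.getD_cons_succ]

theorem clausePos_add_le (hj : j < cl.length) :
    clausePos cl j + 1 + (cl.getD j []).length ≤ (formulaWords n cl).length := by
  obtain ⟨p, s, hp, h⟩ := formulaWords_eq (n := n) hj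
  simp only [h, List.length_append, List.length_cons]
  omega

theorem clausePos_zero : clausePos cl 0 = 2 := by simp [clausePos, clauseWords]

theorem clausePos_succ (hj : j < cl.length) :
    clausePos cl (j + 1) = clausePos cl j + 1 + (cl.getD j []).length := by
  rw [clausePos, List.take_succ_eq_append_getElem hj, List.getD_eq_getElem _ _ hj, clauseWords,
    List.flatMap_append, List.length_append, clausePos, clauseWords]
  simp only [List.flatMap_cons, List.flatMap_nil, List.append_nil, List.length_cons]
  omega

theorem clausePos_length : clausePos cl cl.length = (formulaWords n cl).length := by
  simp [clausePos, formulaWords]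
  omega

/-- Even an empty clause contributes its length word, and there are two header words. This bounds
the number of clauses by the input length. -/
theorem length_le_length_formulaWords : cl.length + 2 ≤ (formulaWords n cl).length := by
  suffices cl.length ≤ (clauseWords cl).length by simpa [formulaWords]
  induction cl with
  | nil => simp
  | cons a l ih => simp_all [clauseWords]; omega

/-- The memory with the words `x` from `0` on, followed by the words `y`. -/
def memOf (x y : List ℕ) (a : ℕ) : ℕ := if a < x.length then x.getD a 0 else y.getD (a - x.length) 0

theorem memOf_nil (x : List ℕ) : memOf x [] = fun a => x.getD a 0 := by
  funext a
  unfold memOf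
  split_ifs with h
  · rfl
  · rw [List.getD_eq_default _ _ (not_lt.1 h), List.getD_nil]

theorem memOf_of_lt {x y : List ℕ} {a : ℕ} (h : a < x.length) : memOf x y a = x.getD a 0 := if_pos h

/-- Unwritten cells read as zero. This reserves the cell for the number of edges without a store;
`update_memOf_second` fills it in later. -/
theorem memOf_append_zero (x y : List ℕ) : memOf x (y ++ [0]) = memOf x y := by
  funext a
  unfold memOf
  split_ifs with h
  · rfl
  · generalize a - x.length = b
    rcases lt_trichotomy b y.length with hb | hb | hb
    · rw [List.getD_append _ _ _ _ hb]
    · subst hb; simp [List.getD_eq_getElem?_getD]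
    · rw [List.getD_eq_default _ _ (by simp; omega), List.getD_eq_default _ _ (by omega)]

theorem update_memOf (x y : List ℕ) (v : ℕ) :
    Function.update (memOf x y) (x.length + y.length) v = memOf x (y ++ [v]) := by
  funext a
  rw [Function.update_apply]
  unfold memOf
  split_ifs with h h' h'
  · omega
  · subst h; simp [List.getD_eq_getElem?_getD]
  · rfl
  · rcases lt_or_ge (a - x.length) y.length with hb | hb
    · rw [List.getD_append _ _ _ _ hb]
    · rw [List.getD_eq_default _ _ hb, List.getD_eq_default _ _ (by simp; omega)]

theorem update_memOf_second (x y : List ℕ) (u v v' : ℕ) :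
    Function.update (memOf x (u :: v :: y)) (x.length + 1) v' = memOf x (u :: v' :: y) := by
  funext a
  rw [Function.update_apply]
  unfold memOf
  split_ifs with h h' h'
  · omega
  · subst h; simp
  · rfl
  · obtain ⟨b, rfl⟩ := Nat.exists_eq_add_of_le (not_lt.1 h')
    rw [Nat.add_sub_cancel_left]
    match b with
    | 0 => rfl
    | 1 => omega
    | b + 2 => rfl

end HalfGraph

/-! ### The program that writes the graph -/

namespace HalfGraph

open RAM RAM.Cmd

/-- Write an edge. -/
def emit (u v : ℕ) : Cmd :=
  .store 8 u ;; .op .add 8 8 1 ;; .store 8 v ;; .op .add 8 8 1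

/-- Find the end of the formula. -/
def scan : Cmd :=
  -- Register 16 is never written and serves as the constant zero.
  .const 1 1 ;; .const 2 2 ;; .load 3 16 ;; .load 4 1 ;; .const 11 2 ;;
  .whileLt 10 4 (.load 12 11 ;; .op .add 11 11 12 ;; .op .add 11 11 1 ;; .op .add 10 10 1)

/-- Compute the parameters and write the number of vertices. -/
def prepare : Cmd :=
  .op .add 5 16 11 ;; .op .add 6 3 1 ;; .op .div 6 6 2 ;; .op .shl 7 1 6 ;; .op .add 21 7 7 ;;
  .op .add 22 4 2 ;; .op .add 8 16 5 ;; .op .add 17 21 22 ;; .store 8 17 ;;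
  -- The second increment skips the cell for the number of edges, which is known only at the end.
  .op .add 8 8 1 ;; .op .add 8 8 1

/-- Write the edges between hubs and clauses. -/
def writeHubs : Cmd :=
  emit 16 1 ;; .const 10 0 ;;
  .whileLt 10 4 (.op .add 25 10 2 ;; emit 16 25 ;; emit 1 25 ;; .op .add 10 10 1)

/-- Test whether a literal holds. -/
def testLit : Cmd :=
  .load 17 11 ;; .op .div 18 17 2 ;; .op .mod 24 17 2 ;; .op .div 19 18 6 ;; .op .mod 18 18 6 ;;
  .op .shr 20 9 18 ;; .op .mod 20 20 2 ;; .op .add 11 11 1 ;;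
  .ifEq 19 14 (.ifEq 20 24 (.const 13 1))

/-- Test whether a clause holds and write an edge if it does not. -/
def testClause : Cmd :=
  .load 17 11 ;; .op .add 11 11 1 ;; .op .add 12 11 17 ;; .const 13 0 ;; .whileLt 11 12 testLit ;;
  .op .add 25 10 2 ;; .op .add 10 10 1 ;; .ifEq 13 16 (emit 25 15)

/-- Write the edges at the half assignments. -/
def writeHalves : Cmd :=
  .const 9 0 ;;
  .whileLt 9 21 (.op .div 14 9 7 ;; .op .add 15 22 9 ;; emit 14 15 ;; .const 10 0 ;; .const 11 2 ;;
    .whileLt 10 4 testClause ;; .op .add 9 9 1)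

/-- Write the number of edges. -/
def writeSize : Cmd :=
  -- Between the base and the write pointer there are two header words and two words per edge.
  .op .sub 17 8 5 ;; .op .sub 17 17 2 ;; .op .div 17 17 2 ;; .op .add 19 5 1 ;; .store 19 17

/-- Write the graph behind the formula. -/
def writeGraph : Cmd := scan ;; prepare ;; writeHubs ;; writeHalves ;; writeSize

/-- The machine holds the formula, the output words `out` behind it, and the parameters. -/
structure Cfg (h m : ℕ) (enc out : List ℕ) (σ : Store) : Prop where
  one : σ.reg 1 = 1
  two : σ.reg 2 = 2
  clauses : σ.reg 4 = m
  base : σ.reg 5 = enc.length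
  half : σ.reg 6 = h
  pow : σ.reg 7 = 2 ^ h
  ptr : σ.reg 8 = enc.length + out.length
  zero : σ.reg 16 = 0
  halves : σ.reg 21 = 2 * 2 ^ h
  offset : σ.reg 22 = m + 2
  -- Registers from 26 on are reserved for the program that runs afterwards and must find its
  -- registers zero.
  high : ∀ r, 26 ≤ r → σ.reg r = 0
  mem : σ.mem = memOf enc out

variable {w h m n : ℕ} {enc out : List ℕ} {cl : List (List ℕ)} {σ : Store} {Q : Store → Prop}

/-- The listed registers are working space, on which `Cfg` puts no condition: 9 is the half
assignment, 10 the clause number, 11 the read address, 12 the end of the clause, 13 the flag, 14 and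
15 the hub and the vertex; the others are temporary. -/
theorem Cfg.set (hσ : Cfg h m enc out σ) {d : ℕ}
    (hd : d ∈ [9, 10, 11, 12, 13, 14, 15, 17, 18, 19, 20, 24, 25]) (v : ℕ) :
    Cfg h m enc out (σ.set d v) := by
  have aux : ∀ r, r ∉ [9, 10, 11, 12, 13, 14, 15, 17, 18, 19, 20, 24, 25] →
      (σ.set d v).reg r = σ.reg r := fun r hr => by
    rw [Store.set_reg, if_neg]
    rintro rfl
    exact hr hd
  constructor
  case high =>
    intro r hr
    rw [aux r (by simp; omega), hσ.high r hr]
  case mem => exact hσ.mem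
  all_goals rw [aux _ (by decide)]
  exacts [hσ.one, hσ.two, hσ.clauses, hσ.base, hσ.half, hσ.pow, hσ.ptr, hσ.zero, hσ.halves,
    hσ.offset]

/-- The write pointer in register 8 moves between the two stores, so the second endpoint must not be
read from it. -/
theorem Cfg.emit (hσ : Cfg h m enc out σ) {u v : ℕ} (hv : v ≠ 8)
    (hw : enc.length + out.length + 2 < 2 ^ w)
    (hQ : ∀ σ', Cfg h m enc (out ++ [σ.reg u, σ.reg v]) σ' → (∀ r, r ≠ 8 → σ'.reg r = σ.reg r) →
      Q σ') :
    Ach w (emit u v) σ 4 Q := by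
  have hone := hσ.one
  have hptr := hσ.ptr
  refine .step (.store ?_)
  refine .step (.add ?_ ?_)
  · simp; omega
  refine .step (.store ?_)
  refine .add ?_ ?_
  · simp [Store.set_reg]; omega
  apply hQ
  · constructor
    case high => intro r hr; simp [Store.set_reg, show r ≠ 8 by omega, hσ.high r hr]
    case mem =>
      simp only [Store.set_mem, Store.poke_mem, Store.poke_reg, Store.set_reg, hptr, hone, hσ.mem,
        if_true, if_neg hv]
      rw [update_memOf, Nat.add_assoc, show out.length + 1 = (out ++ [σ.reg u]).length by simp,
        update_memOf]
      simp
    case ptr => simp [Store.set_reg, hptr, hone]; omega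
    all_goals simp [Store.set_reg]
    exacts [hone, hσ.two, hσ.clauses, hσ.base, hσ.half, hσ.pow, hσ.zero, hσ.halves, hσ.offset]
  · intro r hr
    simp [Store.set_reg, hr]

/-- Registers `9`, `14`, `15` describe the half assignment `i`. -/
def AtHalf (h m i : ℕ) (σ : Store) : Prop :=
  σ.reg 9 = i ∧ σ.reg 14 = i / 2 ^ h ∧ σ.reg 15 = m + 2 + i

/-- The flag is only ever raised, so it accumulates a disjunction over the literals read. The outer
comparison checks that the variable lies in the half of `i`, the inner one that its bit agrees with
the sign. -/
theorem testLit_spec {i e : ℕ} {b : Bool} (hσ : Cfg h m enc out σ) (hi : AtHalf h m i σ)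
    (h13 : σ.reg 13 = b.toNat) (hp : σ.reg 11 < enc.length) (hw : enc.length < 2 ^ w)
    (h1 : 1 < 2 ^ w) (h12 : σ.reg 12 = e) :
    Ach w testLit σ 13 fun σ' => Cfg h m enc out σ' ∧ AtHalf h m i σ' ∧ σ'.reg 12 = e ∧
      σ'.reg 10 = σ.reg 10 ∧ σ'.reg 11 = σ.reg 11 + 1 ∧
      σ'.reg 13 = (b || litHolds h i (enc.getD (σ.reg 11) 0)).toNat := by
  obtain ⟨h9, h14, h15⟩ := hi
  have hx : σ.mem (σ.reg 11) = enc.getD (σ.reg 11) 0 := by rw [hσ.mem, memOf_of_lt hp]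
  generalize enc.getD (σ.reg 11) 0 = x at hx ⊢
  refine .step (.load ?_)
  refine .step (.div ?_)
  refine .step (.mod ?_)
  refine .step (.div ?_)
  refine .step (.mod ?_)
  refine .step (.shr ?_)
  refine .step (.mod ?_)
  refine .step (.add ?_ ?_)
  · simp [Store.set_reg, hσ.one]; omega
  refine .ifEq (fun g1 => .ifEq (fun g2 => .const h1 ?_) (fun g2 => ?_)) (fun g1 => ?_)
  all_goals
    refine ⟨?_, ?_, ?_, ?_, ?_, ?_⟩
    · repeat refine Cfg.set ?_ (by decide) _
      exact hσ
    · simp [AtHalf, Store.set_reg, h9, h14, h15]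
    · simp [Store.set_reg, h12]
    · simp [Store.set_reg]
    · simp [Store.set_reg, hσ.one]
    · simp only [Store.set_reg, Nat.reduceEqDiff, if_true, if_false, hσ.two, hσ.half, h9, h14, hx]
        at g1
      try simp only [Store.set_reg, Nat.reduceEqDiff, if_true, if_false, hσ.two, hσ.half, h9,
        hx] at g2
      simp [Store.set_reg, litHolds, *]

theorem testClause_spec {i j : ℕ} (hσ : Cfg h cl.length (formulaWords n cl) out σ)
    (hi : AtHalf h cl.length i σ) (h10 : σ.reg 10 = j) (h11 : σ.reg 11 = clausePos cl j)
    (hj : j < cl.length) (hw : (formulaWords n cl).length + out.length + 2 < 2 ^ w) :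
    Ach w testClause σ ((cl.getD j []).length * 15 + 14) fun σ' =>
      Cfg h cl.length (formulaWords n cl) (out ++ if (cl.getD j []).any (litHolds h i) then []
        else [j + 2, cl.length + 2 + i]) σ' ∧
      AtHalf h cl.length i σ' ∧ σ'.reg 10 = j + 1 ∧ σ'.reg 11 = clausePos cl (j + 1) := by
  have hpos := clausePos_add_le (n := n) hj
  have hlen := getD_clausePos (n := n) hj
  have hlen' := length_le_length_formulaWords (cl := cl) (n := n)
  have hget : ∀ k < (cl.getD j []).length, _ := fun k => getD_clausePos_add (n := n) hj
  rw [clausePos_succ hj]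
  generalize formulaWords n cl = enc at *
  generalize cl.getD j [] = K at *
  generalize clausePos cl j = p at *
  generalize cl.length = m at *
  have hx : σ.mem p = K.length := by rw [hσ.mem, memOf_of_lt (by omega), hlen]
  -- The 8 pays for what follows the loop: two additions and a conditional `emit`.
  refine Ach.mono_time (T := 8 + (K.length * (13 + 2) + 2) + 1 + 1 + 1 + 1) ?_ (by omega)
  refine .step (.load ?_)
  refine .step (.add ?_ ?_)
  · simp [Store.set_reg, hσ.one]; omega
  refine .step (.add ?_ ?_)
  · simp [Store.set_reg, hσ.one, h11, hx]; omega
  refine .step (.const (by positivity) ?_)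
  refine .seq (.mono (.whileLt (N := K.length) (fun k σ' => Cfg h m enc out σ' ∧ AtHalf h m i σ' ∧
    σ'.reg 12 = p + 1 + K.length ∧ σ'.reg 10 = j ∧ σ'.reg 11 = p + 1 + k ∧
    σ'.reg 13 = ((K.take k).any (litHolds h i)).toNat) ?_ ?_ ?_) le_rfl ?_)
  · rintro k hk σ' ⟨-, -, g12, -, g11, -⟩
    omega
  · rintro k hk σ' ⟨gσ, gi, g12, g10, g11, g13⟩
    refine (testLit_spec gσ gi g13 (by omega) (by omega) (by omega) g12).mono le_rfl ?_
    rintro σ'' ⟨fσ, fi, f12, f10, f11, f13⟩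
    refine ⟨fσ, fi, f12, by omega, by omega, ?_⟩
    rw [f13, g11, hget k hk, List.take_succ_eq_append_getElem hk, List.getD_eq_getElem _ _ hk]
    simp only [List.any_append, List.any_cons, List.any_nil, Bool.or_false]
  · obtain ⟨h9, h14, h15⟩ := hi
    refine ⟨?_, ?_, ?_, ?_, ?_, ?_⟩
    · repeat refine Cfg.set ?_ (by decide) _
      exact hσ
    all_goals simp [AtHalf, Store.set_reg, *, hσ.one]
  · rintro σ' ⟨gσ, ⟨g9, g14, g15⟩, g12, g10, g11, g13⟩
    refine .step (.add ?_ ?_)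
    · simp [g10, gσ.two]; omega
    refine .step (.add ?_ ?_)
    · simp [Store.set_reg, g10, gσ.one]; omega
    rw [List.take_length] at g13
    have gσ' := (gσ.set (d := 25) (by decide) (σ'.reg 10 + σ'.reg 2)).set (d := 10) (by decide)
      ((σ'.set 25 (σ'.reg 10 + σ'.reg 2)).reg 10 + (σ'.set 25 (σ'.reg 10 + σ'.reg 2)).reg 1)
    refine .ifEq (fun e => gσ'.emit (by decide) hw ?_) (fun e => ?_)
    · intro σ'' fσ hr
      have hK : K.any (litHolds h i) = false := by
        simpa [Store.set_reg, gσ.zero, g13] using e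
      refine ⟨?_, ⟨?_, ?_, ?_⟩, ?_, ?_⟩
      · simpa [hK, Store.set_reg, g10, gσ.two, g15] using fσ
      all_goals
        rw [hr _ (by decide)]
        simp [Store.set_reg, *, gσ.one]
    · have hK : K.any (litHolds h i) = true := by
        simpa [Store.set_reg, gσ.zero, g13] using e
      refine ⟨?_, ⟨?_, ?_, ?_⟩, ?_, ?_⟩
      · simpa [hK] using gσ'
      all_goals simp [Store.set_reg, *, gσ.one]

theorem writeHubs_spec (hσ : Cfg h cl.length enc out σ)
    (hw : enc.length + out.length + 4 * cl.length + 4 < 2 ^ w) :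
    Ach w writeHubs σ (cl.length * 12 + 7) fun σ' =>
      Cfg h cl.length enc (out ++ edgeWords ((0, 1) :: hubEdges cl.length)) σ' := by
  generalize cl.length = m at *
  refine Ach.mono_time (T := (m * (10 + 2) + 2) + 1 + 4) ?_ (by omega)
  refine .seq (hσ.emit (by decide) (by omega) fun σ' gσ hr => ?_)
  rw [hσ.zero, hσ.one] at gσ
  refine .step (.const (by positivity) ?_)
  refine .mono (.whileLt (N := m) (fun k σ' => Cfg h m enc (out ++ edgeWords ((0, 1) :: hubEdges k))
    σ' ∧ σ'.reg 10 = k) ?_ ?_ ?_) le_rfl fun σ' h => h.1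
  · rintro k - σ' ⟨gσ, g10⟩
    rw [g10, gσ.clauses]
  · rintro k hk σ' ⟨gσ, g10⟩
    have hlen : (out ++ edgeWords ((0, 1) :: hubEdges k)).length = out.length + 2 + 4 * k := by
      simp [length_hubEdges]
      omega
    refine .step (.add ?_ ?_)
    · rw [g10, gσ.two]
      omega
    refine .seq ((gσ.set (by decide) _).emit (by decide) (by omega) fun σ₁ gσ₁ hr₁ => ?_)
    refine .seq (gσ₁.emit (by decide) (by
      rw [List.length_append, hlen]; simp only [List.length_cons, List.length_nil]; omega)
      fun σ₂ gσ₂ hr₂ => ?_)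
    have e10 : σ₂.reg 10 = k := by simp [hr₁, hr₂, Store.set_reg, g10]
    refine .add ?_ ?_
    · rw [e10, gσ₂.one]
      omega
    refine ⟨?_, by simp [Store.set_reg, e10, gσ₂.one]⟩
    refine Cfg.set ?_ (by decide) _
    have e : edgeWords ((0, 1) :: hubEdges (k + 1)) =
        edgeWords ((0, 1) :: hubEdges k) ++ [0, k + 2, 1, k + 2] := by
      rw [hubEdges_succ, ← List.cons_append, edgeWords_append]
      rfl
    rw [e]
    simpa [hr₁, Store.set_reg, g10, gσ.two, gσ.zero, gσ.one] using gσ₂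
  · refine ⟨?_, by simp [Store.set_reg]⟩
    refine Cfg.set ?_ (by decide) _
    simpa [hubEdges, edgeWords] using gσ

/-- Bounds the output at every moment of the inner loop, so that the write pointer fits into a word
throughout. -/
theorem length_halfEdges_add_le {i j k : ℕ} (hi : i < k) (hj : j ≤ cl.length) :
    (halfEdges h cl i).length + 1 + (missEdges h cl i j).length ≤ k * (cl.length + 1) := by
  have h1 := length_halfEdges_le (h := h) (cl := cl) (k := i)
  have h2 := length_missEdges_le (h := h) (cl := cl) (i := i) (k := j)
  have h3 := Nat.mul_le_mul_right (cl.length + 1) hi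
  rw [Nat.succ_mul] at h3
  omega

theorem writeHalves_spec (hσ : Cfg h cl.length (formulaWords n cl) out σ)
    (hw : (formulaWords n cl).length + out.length + 2 * (2 * 2 ^ h * (cl.length + 1)) + 4 +
      2 * 2 ^ h < 2 ^ w) :
    Ach w writeHalves σ (2 * 2 ^ h *
      (cl.length * ((formulaWords n cl).length * 15 + 16) + 13) + 3) fun σ' =>
      Cfg h cl.length (formulaWords n cl) (out ++ edgeWords (halfEdges h cl (2 * 2 ^ h))) σ' := by
  have hlen' := length_le_length_formulaWords (cl := cl) (n := n)
  set enc := formulaWords n cl with henc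
  set m := cl.length with hm
  refine Ach.mono_time
    (T := (2 * 2 ^ h) * ((1 + (m * ((enc.length * 15 + 14) + 2) + 2) + 1 + 1 + 4 + 1 + 1) + 2) + 2 + 1)
    ?_ (by ring_nf; omega)
  refine .step (.const (by positivity) ?_)
  refine .mono (.whileLt (N := 2 * 2 ^ h) (fun i σ' => Cfg h m enc (out ++
    edgeWords (halfEdges h cl i)) σ' ∧ σ'.reg 9 = i) ?_ ?_ ?_) le_rfl fun σ' h => h.1
  · rintro k - σ' ⟨gσ, g9⟩
    rw [g9, gσ.halves]
  · rintro i hi σ' ⟨gσ, g9⟩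
    have hlen : ∀ j ≤ m, (halfEdges h cl i).length + 1 + (missEdges h cl i j).length ≤
      2 * 2 ^ h * (m + 1) := fun j hj => length_halfEdges_add_le hi hj
    have hlen0 := hlen 0 (Nat.zero_le _)
    refine .step (.div ?_)
    refine .step (.add ?_ ?_)
    · simp [Store.set_reg, g9, gσ.offset]
      omega
    refine .seq (T := 4) (Cfg.emit (u := 14) (v := 15) ((gσ.set (d := 14) (by decide) _).set (d := 15) (by decide) _)
      (by decide) ?_ ?_)
    · simp
      omega
    intro σ₁ gσ₁ hr₁
    refine .step (.const (by positivity) ?_)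
    refine .step (.const (by omega) ?_)
    refine .seq (.mono (.whileLt (N := m) (fun j σ' => Cfg h m enc (out ++
      edgeWords (halfEdges h cl i ++ (i / 2 ^ h, m + 2 + i) :: missEdges h cl i j)) σ' ∧
      AtHalf h m i σ' ∧ σ'.reg 10 = j ∧ σ'.reg 11 = clausePos cl j) ?_ ?_ ?_) le_rfl ?_)
    · rintro j - σ' ⟨fσ, -, f10, -⟩
      rw [f10, fσ.clauses]
    · rintro j hj σ' ⟨fσ, fi, f10, f11⟩
      have hpos := clausePos_add_le (n := n) hj
      rw [← henc] at hpos
      have hlenj := hlen j hj.le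
      refine (testClause_spec fσ fi f10 f11 hj ?_).mono ?_ ?_
      · simp only [List.length_append, length_edgeWords, List.length_cons, ← henc]
        omega
      · omega
      · rintro σ'' ⟨eσ, ei, e10, e11⟩
        refine ⟨?_, ei, e10, e11⟩
        cases hK : (cl.getD j []).any (litHolds h i)
        · rw [missEdges_succ_of_false hK, ← List.cons_append, ← List.append_assoc, edgeWords_append,
            ← List.append_assoc]
          rw [hK] at eσ
          simpa [edgeWords] using eσ
        · rw [missEdges_succ_of_true hK]
          simpa only [hK, if_true, List.append_nil] using eσ
    · refine ⟨?_, ⟨?_, ?_, ?_⟩, ?_, ?_⟩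
      · repeat refine Cfg.set ?_ (by decide) _
        simpa [Store.set_reg, g9, gσ.pow, gσ.offset, missEdges, edgeWords] using gσ₁
      all_goals simp [Store.set_reg, hr₁, g9, gσ.pow, gσ.offset, clausePos_zero]
    · rintro σ₂ ⟨fσ, fi, f10, f11⟩
      refine .add ?_ ?_
      · rw [fi.1, fσ.one]
        omega
      refine ⟨?_, by simp [Store.set_reg, fi.1, fσ.one]⟩
      rw [halfEdges_succ]
      exact fσ.set (by decide) _
  · refine ⟨?_, by simp [Store.set_reg]⟩
    refine Cfg.set ?_ (by decide) _
    simpa [halfEdges, edgeWords] using hσ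

theorem scan_spec (hw : (formulaWords n cl).length < 2 ^ w) :
    Ach w scan ⟨fun _ => 0, fun a => (formulaWords n cl).getD a 0⟩ (cl.length * 6 + 7) fun σ =>
      (∀ r, r ∉ [1, 2, 3, 4, 10, 11, 12] → σ.reg r = 0) ∧ σ.reg 1 = 1 ∧ σ.reg 2 = 2 ∧ σ.reg 3 = n ∧
        σ.reg 4 = cl.length ∧ σ.reg 11 = (formulaWords n cl).length ∧
        σ.mem = memOf (formulaWords n cl) [] := by
  have hlen := length_le_length_formulaWords (cl := cl) (n := n)
  refine Ach.mono_time (T := (cl.length * (4 + 2) + 2) + 1 + 1 + 1 + 1 + 1) ?_ (by omega)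
  refine .step (.const (by omega) ?_)
  refine .step (.const (by omega) ?_)
  refine .step (.load ?_)
  refine .step (.load ?_)
  refine .step (.const (by omega) ?_)
  refine .mono (.whileLt (N := cl.length) (fun k σ =>
    (∀ r, r ∉ [1, 2, 3, 4, 10, 11, 12] → σ.reg r = 0) ∧ σ.reg 1 = 1 ∧ σ.reg 2 = 2 ∧ σ.reg 3 = n ∧
      σ.reg 4 = cl.length ∧ σ.reg 11 = clausePos cl k ∧ σ.mem = memOf (formulaWords n cl) [] ∧
      σ.reg 10 = k) ?_ ?_ ?_) le_rfl ?_
  · rintro k - σ ⟨-, -, -, -, h4, -, -, h10⟩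
    rw [h4, h10]
  · rintro k hk σ ⟨h0, h1, h2, h3, h4, h11, hm, h10⟩
    have hpos := clausePos_add_le (n := n) hk
    have hx : σ.mem (clausePos cl k) = (cl.getD k []).length := by
      rw [hm, memOf_of_lt (by omega), getD_clausePos hk]
    refine .step (.load ?_)
    refine .step (.add ?_ ?_)
    · simp only [Store.set_reg, Nat.reduceEqDiff, if_true, if_false, h11, hx]
      omega
    refine .step (.add ?_ ?_)
    · simp only [Store.set_reg, Nat.reduceEqDiff, if_true, if_false, h11, hx, h1]
      omega
    refine .add ?_ ?_
    · simp only [Store.set_reg, Nat.reduceEqDiff, if_true, if_false, h10, h1]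
      omega
    refine ⟨fun r hr => ?_, ?_⟩
    · have := h0 r hr
      simp only [List.mem_cons, not_or] at hr
      simp [Store.set_reg, *]
    · rw [clausePos_succ hk]
      simp only [Store.set_reg, Nat.reduceEqDiff, if_true, if_false, h10, h1, h2, h3, h4, h11, hx,
        Store.set_mem, true_and, and_true]
      exact ⟨by omega, hm⟩
  · refine ⟨fun r hr => ?_, ?_⟩
    · simp only [List.mem_cons, not_or] at hr
      simp [Store.set_reg, *]
    · simp [Store.set_reg, clausePos_zero, memOf_nil, formulaWords]
  · rintro σ ⟨h0, h1, h2, h3, h4, h11, hm, -⟩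
    exact ⟨h0, h1, h2, h3, h4, h11.trans clausePos_length, hm⟩

theorem prepare_spec (h1 : ∀ r, r ∉ [1, 2, 3, 4, 10, 11, 12] → σ.reg r = 0) (hone : σ.reg 1 = 1)
    (htwo : σ.reg 2 = 2) (h3 : σ.reg 3 = n) (h4 : σ.reg 4 = m) (h11 : σ.reg 11 = enc.length)
    (hm : σ.mem = memOf enc []) (hn : n + 1 < 2 ^ w)
    (hw : enc.length + 2 * 2 ^ ((n + 1) / 2) + m + 2 < 2 ^ w) :
    Ach w prepare σ 11
      (Cfg ((n + 1) / 2) m enc [2 * 2 ^ ((n + 1) / 2) + (m + 2), 0]) := by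
  set h := (n + 1) / 2 with hh
  have h5 := h1 5 (by decide)
  have h16 := h1 16 (by decide)
  refine .step (.op_eq (v := enc.length) (by simp [Op.eval, h16, h11]) (by omega) ?_)
  refine .step (.op_eq (v := n + 1) (by simp [Op.eval, Store.set_reg, h3, hone]) hn ?_)
  refine .step (.op_eq (v := h) (by simp [Op.eval, Store.set_reg, htwo, hh]) (by omega) ?_)
  refine .step (.op_eq (v := 2 ^ h) (by simp [Op.eval, Store.set_reg, hone, Nat.shiftLeft_eq])
    (by omega) ?_)
  refine .step (.op_eq (v := 2 * 2 ^ h) (by simp [Op.eval, Store.set_reg, two_mul]) (by omega) ?_)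
  refine .step (.op_eq (v := m + 2) (by simp [Op.eval, Store.set_reg, h4, htwo]) (by omega) ?_)
  refine .step (.op_eq (v := enc.length) (by simp [Op.eval, Store.set_reg, h16]) (by omega) ?_)
  refine .step (.op_eq (v := 2 * 2 ^ h + (m + 2)) (by simp [Op.eval, Store.set_reg]) (by omega) ?_)
  refine .step (.store ?_)
  refine .step (.op_eq (v := enc.length + 1) (by simp [Op.eval, Store.set_reg, hone]) (by omega) ?_)
  refine .op_eq (v := enc.length + 2) (by simp [Op.eval, Store.set_reg, hone]) (by omega) ?_
  constructor
  case high =>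
    intro r hr
    have := h1 r (by simp; omega)
    simp (disch := omega) only [Store.set_reg, Store.poke_reg, if_neg, this]
  case mem =>
    rw [show ∀ u : ℕ, [u, 0] = ([] ++ [u]) ++ [0] from fun _ => rfl, memOf_append_zero,
      ← update_memOf]
    simp [Store.set_reg, Store.poke_mem, hm]
  all_goals simp [Store.set_reg, hone, htwo, h4, h16]

theorem writeSize_spec {E : List (ℕ × ℕ)} {u v : ℕ}
    (hσ : Cfg h m enc (u :: v :: edgeWords E) σ) (hw : enc.length + 1 < 2 ^ w) :
    Ach w writeSize σ 5 fun σ' => (∀ r, 26 ≤ r → σ'.reg r = 0) ∧ σ'.reg 1 = 1 ∧ σ'.reg 2 = 2 ∧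
      σ'.reg 5 = enc.length ∧ σ'.reg 16 = 0 ∧
      σ'.mem = memOf enc (u :: E.length :: edgeWords E) := by
  have hptr := hσ.ptr
  simp only [List.length_cons, length_edgeWords] at hptr
  refine .step (.sub ?_)
  refine .step (.sub ?_)
  refine .step (.div ?_)
  refine .step (.add ?_ ?_)
  · simpa [Store.set_reg, hσ.base, hσ.one] using hw
  refine .store ⟨fun r hr => ?_, ?_, ?_, ?_, ?_, ?_⟩
  · simp (disch := omega) only [Store.set_reg, Store.poke_reg, if_neg, hσ.high r hr]
  case refine_6 =>
    have e : (enc.length + (2 * E.length + 1 + 1) - enc.length - 2) / 2 = E.length := by omega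
    simp only [Store.poke_mem, Store.set_mem, Store.set_reg, Nat.reduceEqDiff, if_true, if_false,
      hσ.base, hσ.one, hσ.two, hptr, e, hσ.mem, update_memOf_second]
  all_goals simp [Store.set_reg, hσ.one, hσ.two, hσ.base, hσ.zero]

/-- A bound for the number of edges. -/
def sizeBound (n : ℕ) (cl : List (List ℕ)) : ℕ :=
  1 + 2 * cl.length + 2 * 2 ^ ((n + 1) / 2) * (cl.length + 1)

theorem writeGraph_spec (hn : n + 1 < 2 ^ w)
    (hw : (formulaWords n cl).length + 3 * sizeBound n cl + 10 < 2 ^ w) :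
    Ach w writeGraph ⟨fun _ => 0, fun a => (formulaWords n cl).getD a 0⟩
      (sizeBound n cl * ((formulaWords n cl).length * 15 + 60)) fun σ =>
      (∀ r, 26 ≤ r → σ.reg r = 0) ∧ σ.reg 1 = 1 ∧ σ.reg 2 = 2 ∧
      σ.reg 5 = (formulaWords n cl).length ∧ σ.reg 16 = 0 ∧
      σ.mem = memOf (formulaWords n cl) (order ((n + 1) / 2) cl ::
        (allEdges ((n + 1) / 2) cl).length :: edgeWords (allEdges ((n + 1) / 2) cl)) := by
  have hlen := length_le_length_formulaWords (cl := cl) (n := n)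
  unfold sizeBound at *
  have hmul : 2 * 2 ^ ((n + 1) / 2) ≤ 2 * 2 ^ ((n + 1) / 2) * (cl.length + 1) :=
    Nat.le_mul_of_pos_right _ (by omega)
  refine Ach.mono_time (T := 5 + (2 * 2 ^ ((n + 1) / 2) *
    (cl.length * ((formulaWords n cl).length * 15 + 16) + 13) + 3) +
    (cl.length * 12 + 7) + 11 + (cl.length * 6 + 7)) ?_ ?_
  · refine .seq ((scan_spec (by omega)).mono le_rfl ?_)
    rintro σ₁ ⟨a0, a1, a2, a3, a4, a11, am⟩
    refine .seq ((prepare_spec a0 a1 a2 a3 a4 a11 am hn (by omega)).mono le_rfl ?_)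
    intro σ₂ h₂
    refine .seq ((writeHubs_spec h₂ ?_).mono le_rfl ?_)
    · simp only [List.length_cons, List.length_nil]
      omega
    intro σ₃ h₃
    refine .seq ((writeHalves_spec h₃ ?_).mono le_rfl ?_)
    · simp only [List.length_cons, List.length_nil, List.length_append, length_edgeWords,
        length_hubEdges]
      omega
    intro σ₄ h₄
    rw [List.append_assoc, ← edgeWords_append, List.cons_append] at h₄
    exact writeSize_spec h₄ (by omega)
  · generalize (formulaWords n cl).length = B at *
    generalize cl.length = m at *
    generalize 2 * 2 ^ ((n + 1) / 2) = K at *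
    nlinarith [Nat.zero_le (K * B), Nat.zero_le (m * B), Nat.zero_le (K * m * B), Nat.zero_le (K * m)]

end HalfGraph

/-! ### Running a program with shifted registers and memory -/

namespace RAM

/-- The instruction number at which the instruction `t` of a shifted program of length `len` stands,
if the shifted program starts at `off`. -/
def shiftPc (off len t : ℕ) : ℕ := off + 2 * min t len

/-- The instruction, with registers shifted by `26` and addresses shifted by register `5`. Register
`23` is used for addresses. -/
def Instr.shift (off len : ℕ) : Instr → List Instr
  | .const d k => [.const 23 0, .const (d + 26) k]
  | .op o d a b => [.const 23 0, .op o (d + 26) (a + 26) (b + 26)]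
  | .load d a => [.op .add 23 5 (a + 26), .load (d + 26) 23]
  | .store a b => [.op .add 23 5 (a + 26), .store 23 (b + 26)]
  | .jlt a b t => [.const 23 0, .jlt (a + 26) (b + 26) (shiftPc off len t)]
  | .jeq a b t => [.const 23 0, .jeq (a + 26) (b + 26) (shiftPc off len t)]

/-- The program with shifted registers and memory, to be placed at `off`. -/
def Program.shift (Q : Program) (off : ℕ) : List Instr := Q.flatMap (Instr.shift off Q.length)

/-- Instructions that need no address computation are padded by a dummy write to register 23; with
blocks of equal length, jump targets are obtained by doubling. -/
theorem Instr.length_shift (off len : ℕ) (i : Instr) : (i.shift off len).length = 2 := by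
  cases i <;> rfl

theorem Program.length_shift (Q : Program) (off : ℕ) : (Q.shift off).length = 2 * Q.length := by
  simp [Program.shift, List.length_flatMap, Instr.length_shift, Nat.mul_comm]

theorem CodeAt.getElem_flatMap {P Q : Program} {f : Instr → List Instr} {o j : ℕ} {i : Instr}
    (hf : ∀ i, (f i).length = 2) (h : CodeAt P o (Q.flatMap f)) (hj : Q[j]? = some i) :
    CodeAt P (o + 2 * j) (f i) := by
  induction Q generalizing o j with
  | nil => simp at hj
  | cons a Q ih =>
    rw [List.flatMap_cons, codeAt_append, hf] at h
    cases j with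
    | zero =>
      obtain rfl : a = i := by simpa using hj
      exact h.1
    | succ j =>
      have := ih h.2 (by simpa using hj)
      rwa [show o + 2 + 2 * j = o + 2 * (j + 1) by omega] at this

/-- The store `σ` holds the shifted registers and memory of `s`, and some constants. -/
structure Shifted (base : ℕ) (s : State) (σ : Store) : Prop where
  reg : ∀ r, σ.reg (r + 26) = s.reg r
  mem : ∀ a, σ.mem (base + a) = s.mem a
  base : σ.reg 5 = base
  one : σ.reg 1 = 1
  two : σ.reg 2 = 2
  zero : σ.reg 16 = 0

variable {P Q : Program} {base off w w' : ℕ} {s : State} {σ : Store}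

theorem Shifted.set_scratch (h : Shifted base s σ) (v : ℕ) : Shifted base s (σ.set 23 v) := by
  constructor
  · intro r
    rw [Store.set_reg, if_neg (by omega), h.reg]
  · exact h.mem
  all_goals rw [Store.set_reg, if_neg (by omega)]
  exacts [h.base, h.one, h.two, h.zero]

theorem Shifted.set (h : Shifted base s σ) (pc d v : ℕ) :
    Shifted base ⟨pc, Function.update s.reg d v, s.mem⟩ (σ.set (d + 26) v) := by
  constructor
  · intro r
    simp [Store.set_reg, Function.update_apply, h.reg]
  · exact h.mem
  all_goals rw [Store.set_reg, if_neg (by omega)]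
  exacts [h.base, h.one, h.two, h.zero]

theorem Shifted.poke (h : Shifted base s σ) (pc a v : ℕ) :
    Shifted base ⟨pc, s.reg, Function.update s.mem a v⟩ (σ.poke (base + a) v) := by
  refine ⟨h.reg, fun b => ?_, h.base, h.one, h.two, h.zero⟩
  simp [Store.poke_mem, Function.update_apply, h.mem]

theorem Shifted.withPc (h : Shifted base s σ) (pc : ℕ) : Shifted base ⟨pc, s.reg, s.mem⟩ σ :=
  ⟨h.reg, h.mem, h.base, h.one, h.two, h.zero⟩

/-- Simulated addresses are below `2 ^ w'`, so `hw` keeps them within a word after the base is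
added. Values written by the simulation also occur in the simulated run and inherit their bound from
it. -/
theorem Shifted.step (h : Shifted base s σ) (hP : CodeAt P off (Q.shift off)) (hs : s.Fits w')
    (hs' : (Q.step s).Fits w') (hσ : σ.Fits w) (hw : base + 2 ^ w' ≤ 2 ^ w)
    (hpc : s.pc < Q.length) :
    ∃ σ', Shifted base (Q.step s) σ' ∧ Reach P w (σ.withPc (shiftPc off Q.length s.pc))
      (σ'.withPc (shiftPc off Q.length (Q.step s).pc)) 2 := by
  have hi : Q[s.pc]? = some Q[s.pc] := by simp [hpc]
  have hst : Q.step s = Q[s.pc].exec s := by simp [Program.step, hi]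
  have hc := hP.getElem_flatMap (Instr.length_shift off Q.length) hi
  have epc : off + 2 * s.pc = shiftPc off Q.length s.pc := by
    rw [shiftPc, min_eq_left hpc.le]
  have epc' : shiftPc off Q.length (s.pc + 1) = shiftPc off Q.length s.pc + 1 + 1 := by
    rw [← epc, shiftPc, min_eq_left hpc]
    omega
  rw [epc] at hc
  rw [hst] at hs' ⊢
  generalize Q[s.pc] = i at *
  have h0 := h.set_scratch 0
  have f0 : (σ.set 23 0).Fits w := hσ.set (by positivity)
  have hle : ∀ {v}, v < 2 ^ w' → v < 2 ^ w := fun hv => by omega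
  cases i with
  | const d k =>
    have hk : k < 2 ^ w := hle (by simpa [Instr.exec] using hs'.1 d)
    exact ⟨_, h0.set _ d k, (Reach.single hc.1 rfl hσ f0).trans
      (.single hc.2.1 (by simp [Instr.exec, epc']; rfl) f0 (f0.set hk))⟩
  | op o d a b =>
    have hk := hle (by simpa [Instr.exec] using hs'.1 d)
    refine ⟨_, h0.set _ d _, (Reach.single hc.1 rfl hσ f0).trans
      (.single hc.2.1 ?_ f0 (f0.set hk))⟩
    simp only [Instr.exec, epc', ← h0.reg]
    rfl
  | load d a =>
    have ha := hs.1 a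
    have hk := hle (by simpa [Instr.exec] using hs'.1 d)
    have h1 := h.set_scratch (base + s.reg a)
    have f1 : (σ.set 23 (base + s.reg a)).Fits w := hσ.set (by omega)
    refine ⟨_, h1.set _ d _, (Reach.single hc.1 ?_ hσ f1).trans
      (.single hc.2.1 ?_ f1 (f1.set hk))⟩
    · simp only [Instr.exec, Op.eval, Store.withPc, h.base, h.reg]
      rfl
    · simp only [Instr.exec, epc', ← h1.mem, Store.withPc, Store.set_reg, if_true]
      rfl
  | store a b =>
    have ha := hs.1 a
    have hk := hle (hs.1 b)
    have h1 := h.set_scratch (base + s.reg a)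
    have f1 : (σ.set 23 (base + s.reg a)).Fits w := hσ.set (by omega)
    refine ⟨_, h1.poke _ _ _, (Reach.single hc.1 ?_ hσ f1).trans
      (.single hc.2.1 ?_ f1 (f1.poke hk))⟩
    · simp only [Instr.exec, Op.eval, Store.withPc, h.base, h.reg]
      rfl
    · simp only [Instr.exec, epc', ← h1.reg b, Store.withPc, Store.set_reg, if_true]
      rfl
  | jlt a b t =>
    refine ⟨_, h0.withPc _, (Reach.single hc.1 rfl hσ f0).trans (.single hc.2.1 ?_ f0 f0)⟩
    simp only [Instr.exec, ← h0.reg, apply_ite (shiftPc off Q.length), epc']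
    rfl
  | jeq a b t =>
    refine ⟨_, h0.withPc _, (Reach.single hc.1 rfl hσ f0).trans (.single hc.2.1 ?_ f0 f0)⟩
    simp only [Instr.exec, ← h0.reg, apply_ite (shiftPc off Q.length), epc']
    rfl

theorem Shifted.run {x : List ℕ} (h : Shifted base (init x) σ) (hP : CodeAt P off (Q.shift off))
    (hσ : σ.Fits w) (hw : base + 2 ^ w' ≤ 2 ^ w) (t : ℕ) (hQ : ∀ i ≤ t, (Q.run x i).Fits w') :
    ∃ t' ≤ 2 * t, ∃ σ', Shifted base (Q.run x t) σ' ∧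
      Reach P w (σ.withPc off) (σ'.withPc (shiftPc off Q.length (Q.run x t).pc)) t' := by
  induction t with
  | zero => exact ⟨0, le_rfl, σ, h, by simpa [shiftPc, Program.run, init] using Reach.refl (s := σ.withPc off) hσ⟩
  | succ t ih =>
    obtain ⟨t', ht', σ', hσ', hr⟩ := ih fun i hi => hQ i (by omega)
    have e : Q.run x (t + 1) = Q.step (Q.run x t) := Function.iterate_succ_apply' _ _ _
    by_cases hpc : (Q.run x t).pc < Q.length
    · obtain ⟨σ'', hσ'', hr'⟩ := hσ'.step hP (hQ t (by omega)) (e ▸ hQ (t + 1) le_rfl)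
        hr.fits_right hw hpc
      rw [e]
      exact ⟨t' + 2, by omega, σ'', hσ'', hr.trans hr'⟩
    -- A halted configuration is stationary, so the simulation has nothing to do.
    · have e' : Q.step (Q.run x t) = Q.run x t := by
        simp [Program.step, not_lt.1 hpc]
      rw [e, e']
      exact ⟨t', by omega, σ', hσ', hr⟩

end RAM

namespace HalfGraph

open RAM RAM.Cmd

/-! ### The assembled satisfiability program -/

/-- Answer whether the result of the shifted program is greater than `2`. -/
def decideResult : Cmd := .op .sub 17 26 2 ;; .const 0 1 ;; .ifEq 17 16 (.const 0 0)

/-- Write the graph, run the program `Q` on it, and answer whether its result is greater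
than `2`. -/
def satProgram (Q : Program) : Program :=
  writeGraph.compile 0 ++
    (Q.shift writeGraph.size ++ decideResult.compile (writeGraph.size + 2 * Q.length))

theorem decideResult_spec {base w : ℕ} {s : State} {σ : Store} (h : Shifted base s σ)
    (hw : 1 < 2 ^ w) :
    Ach w decideResult σ 5 fun σ' => σ'.reg 0 = if 2 < s.reg 0 then 1 else 0 := by
  have h0 := h.reg 0
  -- The truncated difference is zero exactly when the result is at most 2.
  refine .step (.sub ?_)
  refine .step (.const hw ?_)
  refine .ifEq (fun e => .const (by omega) ?_) (fun e => ?_)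
  all_goals
    simp [Store.set_reg, h.zero, h.two] at e h0
    simp [Store.set_reg]
    omega

theorem satProgram_outputs {Q : Program} {n w w' y : ℕ} {cl : List (List ℕ)} {T : ℝ}
    (hQ : Q.Outputs (order ((n + 1) / 2) cl :: (allEdges ((n + 1) / 2) cl).length ::
      edgeWords (allEdges ((n + 1) / 2) cl)) y T w')
    (hn : n + 1 < 2 ^ w) (hfits : ∀ x ∈ formulaWords n cl, x < 2 ^ w)
    (hw : (formulaWords n cl).length + 3 * sizeBound n cl + 10 < 2 ^ w)
    (hw' : (formulaWords n cl).length + 2 ^ w' ≤ 2 ^ w) :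
    (satProgram Q).Outputs (formulaWords n cl) (if 2 < y then 1 else 0)
      (sizeBound n cl * ((formulaWords n cl).length * 15 + 60) + 2 * T + 5) w := by
  obtain ⟨t, ht, hpc, hy, hfit⟩ := hQ
  have hcode := codeAt_append_left [] (satProgram Q)
  rw [List.nil_append, List.length_nil, satProgram, codeAt_append, codeAt_append, length_compile,
    Program.length_shift, Nat.zero_add, ← satProgram] at hcode
  obtain ⟨c1, c2, c3⟩ := hcode
  have hinit : (Store.mk (fun _ => 0) fun a => (formulaWords n cl).getD a 0).Fits w := by
    refine ⟨fun i => by positivity, fun i => ?_⟩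
    dsimp only
    rcases lt_or_ge i (formulaWords n cl).length with hi | hi
    · rw [List.getD_eq_getElem _ _ hi]
      exact hfits _ (List.getElem_mem _)
    · rw [List.getD_eq_default _ _ hi]
      positivity
  obtain ⟨t₁, ht₁, σ₁, ⟨hhigh, h1, h2, h5, h16, hm⟩, r₁⟩ := writeGraph_spec hn hw _ _ c1 hinit
  rw [Nat.zero_add] at r₁
  have hsh : Shifted (formulaWords n cl).length (init (order ((n + 1) / 2) cl ::
      (allEdges ((n + 1) / 2) cl).length :: edgeWords (allEdges ((n + 1) / 2) cl))) σ₁ := by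
    -- Seen from the base, memory holds exactly the encoded graph followed by zeros, the initial
    -- memory of `Q`.
    refine ⟨fun r => hhigh _ (by omega), fun a => ?_, h5, h1, h2, h16⟩
    rw [hm, memOf, if_neg (by omega), Nat.add_sub_cancel_left]
    rfl
  obtain ⟨t₂, ht₂, σ₂, h₂, r₂⟩ := hsh.run c2 r₁.fits_right hw' t hfit
  -- The minimum in `shiftPc` sends every halting value of the counter to the first instruction
  -- behind the shifted code, where `decideResult` stands.
  rw [shiftPc, min_eq_right hpc] at r₂
  obtain ⟨t₃, ht₃, σ₃, h₃, r₃⟩ := decideResult_spec h₂ (by omega) _ _ c3 r₂.fits_right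
  have r := (r₁.trans r₂).trans r₃
  refine ⟨t₁ + t₂ + t₃, ?_, ?_, ?_, r.2⟩
  · have hle : t₁ + t₂ + t₃ ≤ sizeBound n cl * ((formulaWords n cl).length * 15 + 60) + 2 * t + 5 := by
      omega
    have hle' : ((t₁ + t₂ + t₃ : ℕ) : ℝ) ≤ _ := Nat.cast_le.2 hle
    push_cast at hle' ⊢
    linarith
  · change _ ≤ ((satProgram Q).step^[_] _).pc
    erw [r.1]
    simp [satProgram, length_compile, Program.length_shift, Store.withPc]
    omega
  · change ((satProgram Q).step^[_] _).reg 0 = _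
    erw [r.1]
    rw [← hy]
    exact h₃

end HalfGraph

/-! ### The diameter of the graph -/

/-- Putting the smaller endpoint first excludes loops and makes distinct pairs distinct as unordered
edges. -/
theorem SimpleGraph.exists_isEdgeListing (N : ℕ) (L : List (ℕ × ℕ)) (hL : L.Nodup)
    (hlt : ∀ p ∈ L, p.1 < p.2 ∧ p.2 < N) :
    ∃ (G : SimpleGraph (Fin N)) (l : List (Fin N × Fin N)), G.IsEdgeListing l ∧
      l.map (fun p => ((p.1 : ℕ), (p.2 : ℕ))) = L ∧
      ∀ u v, G.Adj u v ↔ ((u : ℕ), (v : ℕ)) ∈ L ∨ ((v : ℕ), (u : ℕ)) ∈ L := by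
  obtain ⟨l, hl⟩ : ∃ l : List (Fin N × Fin N), l.map (fun p => ((p.1 : ℕ), (p.2 : ℕ))) = L := by
    refine ⟨L.pmap (fun p hp => (⟨p.1, hp.1.trans hp.2⟩, ⟨p.2, hp.2⟩)) hlt, ?_⟩
    rw [List.map_pmap]
    exact List.pmap_eq_self.2 fun _ _ => rfl
  subst hl
  have hmem : ∀ u v : Fin N, ((u : ℕ), (v : ℕ)) ∈ l.map (fun p => ((p.1 : ℕ), (p.2 : ℕ))) ↔
      (u, v) ∈ l := by
    intro u v
    simp [← Fin.ext_iff]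
  have hlt' : ∀ p ∈ l, p.1 < p.2 := fun p hp => (hlt _ (List.mem_map_of_mem hp)).1
  refine ⟨.fromEdgeSet {e | e ∈ l.map fun p => s(p.1, p.2)}, l, ⟨?_, fun e => ?_⟩, rfl, ?_⟩
  · refine (List.nodup_map_iff_inj_on hL.of_map).2 fun p hp q hq e => ?_
    have h1 := hlt' p hp
    have h2 := hlt' q hq
    rcases Sym2.eq_iff.1 e with h | h
    · exact Prod.ext h.1 h.2
    · rw [h.1, h.2] at h1
      exact absurd h1 h2.not_gt
  · rw [SimpleGraph.edgeSet_fromEdgeSet]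
    simp only [Set.mem_sdiff, Set.mem_ofPred_eq, iff_self_and]
    intro he hd
    obtain ⟨p, hp, rfl⟩ := List.mem_map.1 he
    exact (hlt' p hp).ne hd
  · intro u v
    rw [SimpleGraph.fromEdgeSet_adj, hmem, hmem]
    constructor
    · rintro ⟨he, -⟩
      obtain ⟨p, hp, e⟩ := List.mem_map.1 he
      rcases Sym2.eq_iff.1 e with h | h
      · exact .inl (by rwa [← h.1, ← h.2])
      · exact .inr (by rwa [← h.1, ← h.2])
    · rintro (h | h)
      · exact ⟨List.mem_map.2 ⟨_, h, rfl⟩, (hlt' _ h).ne⟩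
      · exact ⟨List.mem_map.2 ⟨_, h, Sym2.eq_swap⟩, (hlt' _ h).ne'⟩

theorem SimpleGraph.edist_le_one {V : Type*} {G : SimpleGraph V} {u v : V}
    (h : u = v ∨ G.Adj u v) : G.edist u v ≤ 1 := by
  rcases h with rfl | h
  · simp
  · exact (SimpleGraph.edist_eq_one_iff_adj.2 h).le

theorem SimpleGraph.diam_le_two {V : Type*} {G : SimpleGraph V}
    (h : ∀ u v, ∃ x, (u = x ∨ G.Adj u x) ∧ (x = v ∨ G.Adj x v)) : G.diam ≤ 2 := by
  refine ENat.toNat_le_of_le_natCast (SimpleGraph.ediam_le_of_edist_le fun u v => ?_)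
  obtain ⟨x, h1, h2⟩ := h u v
  calc G.edist u v ≤ G.edist u x + G.edist x v := SimpleGraph.edist_triangle
    _ ≤ 1 + 1 := add_le_add (edist_le_one h1) (edist_le_one h2)
    _ = 2 := one_add_one_eq_two

/-- A shortest walk from `u` to `v` cannot have length 0, 1 or 2. Finiteness and connectedness make
the extended diameter finite; otherwise `diam` would take the default value 0. -/
theorem SimpleGraph.three_le_diam {V : Type*} [Finite V] {G : SimpleGraph V} (hG : G.Connected)
    {u v : V} (h1 : u ≠ v) (h2 : ¬ G.Adj u v) (h3 : ∀ x, ¬ (G.Adj u x ∧ G.Adj x v)) :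
    3 ≤ G.diam := by
  have : Nonempty V := hG.nonempty
  obtain ⟨p, hp⟩ := hG.exists_walk_length_eq_dist u v
  refine le_trans ?_ (SimpleGraph.dist_le_diam (u := u) (v := v)
    (SimpleGraph.connected_iff_ediam_ne_top.1 hG))
  rw [← hp]
  match p with
  | .nil => exact absurd rfl h1
  | .cons h .nil => exact absurd h h2
  | .cons h (.cons h' .nil) => exact absurd ⟨h, h'⟩ (h3 _)
  | .cons _ (.cons _ (.cons _ _)) => simp

namespace HalfGraph

variable {n h i j k u v : ℕ} {cl : List (List ℕ)}

theorem mem_hubEdges : (u, v) ∈ hubEdges k ↔ u ≤ 1 ∧ 2 ≤ v ∧ v < k + 2 := by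
  simp only [hubEdges, List.mem_flatMap, List.mem_range, List.mem_cons, Prod.mk.injEq,
    List.not_mem_nil, or_false]
  constructor
  · rintro ⟨j, hj, h | h⟩ <;> omega
  · rintro ⟨h1, h2, h3⟩
    exact ⟨v - 2, by omega, by omega⟩

theorem mem_missEdges : (u, v) ∈ missEdges h cl i k ↔
    v = cl.length + 2 + i ∧ ∃ j < k, u = j + 2 ∧ (cl.getD j []).any (litHolds h i) = false := by
  simp only [missEdges, List.mem_map, List.mem_filter, List.mem_range, Prod.mk.injEq,
    decide_eq_true_eq]
  constructor
  · rintro ⟨j, ⟨hj, h⟩, rfl, rfl⟩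
    exact ⟨rfl, j, hj, rfl, h⟩
  · rintro ⟨rfl, j, hj, rfl, h⟩
    exact ⟨j, ⟨hj, h⟩, rfl, rfl⟩

theorem mem_halfEdges : (u, v) ∈ halfEdges h cl k ↔ ∃ i < k, v = cl.length + 2 + i ∧
    (u = i / 2 ^ h ∨
      ∃ j < cl.length, u = j + 2 ∧ (cl.getD j []).any (litHolds h i) = false) := by
  simp only [halfEdges, List.mem_flatMap, List.mem_range, List.mem_cons, Prod.mk.injEq,
    mem_missEdges]
  refine exists_congr fun i => and_congr_right fun _ => ?_
  tauto

theorem mem_allEdges : (u, v) ∈ allEdges h cl ↔ (u = 0 ∧ v = 1) ∨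
    (u ≤ 1 ∧ 2 ≤ v ∧ v < cl.length + 2) ∨ ∃ i < 2 * 2 ^ h, v = cl.length + 2 + i ∧
    (u = i / 2 ^ h ∨
      ∃ j < cl.length, u = j + 2 ∧ (cl.getD j []).any (litHolds h i) = false) := by
  simp only [allEdges, List.mem_cons, List.mem_append, Prod.mk.injEq, mem_hubEdges, mem_halfEdges]

theorem nodup_hubEdges : (hubEdges k).Nodup := by
  induction k with
  | zero => simp [hubEdges]
  | succ k ih =>
    rw [hubEdges_succ]
    refine ih.append (by simp) fun p hp hp' => ?_
    have := (mem_hubEdges (u := p.1) (v := p.2)).1 hp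
    simp only [List.mem_cons, List.not_mem_nil, or_false] at hp'
    rcases hp' with rfl | rfl <;> simp at this

theorem nodup_missEdges : (missEdges h cl i k).Nodup :=
  (List.nodup_range.filter _).map fun a b hab => by simpa using hab

/-- The bound on `k` ensures that `i / 2 ^ h` is 0 or 1, so the edge to the hub is not also an edge
to a clause. -/
theorem nodup_halfEdges (hk : k ≤ 2 * 2 ^ h) : (halfEdges h cl k).Nodup := by
  induction k with
  | zero => simp [halfEdges]
  | succ k ih =>
    rw [halfEdges_succ]
    refine (ih (by omega)).append (List.nodup_cons.2 ⟨fun hp => ?_, nodup_missEdges⟩)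
      fun p hp hp' => ?_
    · obtain ⟨-, j, -, hj, -⟩ := mem_missEdges.1 hp
      have : k / 2 ^ h < 2 := Nat.div_lt_of_lt_mul (by omega)
      omega
    · obtain ⟨i, hi, hv, -⟩ := (mem_halfEdges (u := p.1) (v := p.2)).1 hp
      rcases List.mem_cons.1 hp' with rfl | hp'
      · simp at hv
        omega
      · obtain ⟨hv', -⟩ := (mem_missEdges (u := p.1) (v := p.2)).1 hp'
        omega

theorem nodup_allEdges : (allEdges h cl).Nodup := by
  refine List.nodup_cons.2 ⟨fun hp => ?_, nodup_hubEdges.append (nodup_halfEdges le_rfl)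
    fun p hp hp' => ?_⟩
  · rcases List.mem_append.1 hp with hp | hp
    · have := mem_hubEdges.1 hp
      omega
    · obtain ⟨i, hi, hv, -⟩ := mem_halfEdges.1 hp
      omega
  · have := (mem_hubEdges (u := p.1) (v := p.2)).1 hp
    obtain ⟨i, hi, hv, -⟩ := (mem_halfEdges (u := p.1) (v := p.2)).1 hp'
    omega

theorem lt_of_mem_allEdges (p : ℕ × ℕ) (hp : p ∈ allEdges h cl) :
    p.1 < p.2 ∧ p.2 < order h cl := by
  obtain ⟨u, v⟩ := p
  have : 0 < 2 ^ h := by positivity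
  unfold order
  rcases mem_allEdges.1 hp with hp | hp | ⟨i, hi, hv, hu | ⟨j, hj, hu, -⟩⟩
  · dsimp only; omega
  · dsimp only; omega
  · have : i / 2 ^ h < 2 := Nat.div_lt_of_lt_mul (by omega)
    dsimp only; omega
  · dsimp only; omega

/-- Some pair of half assignments, one for each half of the variables, satisfies all clauses. -/
def HalvesSatisfy (h : ℕ) (cl : List (List ℕ)) : Prop :=
  ∃ i < 2 ^ h, ∃ i' < 2 ^ h, ∀ j < cl.length,
    (cl.getD j []).any (litHolds h i) = true ∨ (cl.getD j []).any (litHolds h (2 ^ h + i')) = true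

/-- Half assignments of opposite sides have different hubs, so only a clause missed by both can be a
common neighbour. Every other pair is served by a hub. -/
theorem exists_graph (h : ℕ) (cl : List (List ℕ)) :
    ∃ (G : SimpleGraph (Fin (order h cl))) (l : List (Fin (order h cl) × Fin (order h cl))),
      G.Connected ∧ G.IsEdgeListing l ∧ l.map (fun p => ((p.1 : ℕ), (p.2 : ℕ))) = allEdges h cl ∧
      (HalvesSatisfy h cl → 3 ≤ G.diam) ∧ (¬ HalvesSatisfy h cl → G.diam ≤ 2) := by
  obtain ⟨G, l, hl, hmap, hadj⟩ := SimpleGraph.exists_isEdgeListing (order h cl) (allEdges h cl)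
    nodup_allEdges lt_of_mem_allEdges
  have hK : 0 < 2 ^ h := by positivity
  have hN : order h cl = 2 * 2 ^ h + (cl.length + 2) := rfl
  have hadj' : ∀ u v : Fin (order h cl), (u : ℕ) < v → (G.Adj u v ↔ (u.val, v.val) ∈ allEdges h cl) := by
    intro u v huv
    rw [hadj, or_iff_left]
    intro hvu
    have := (lt_of_mem_allEdges _ hvu).1
    dsimp only at this
    omega
  -- the hubs that are equal or adjacent to a vertex
  have hub : ∀ (u s : Fin (order h cl)), (s : ℕ) ≤ 1 →
      ((u : ℕ) < cl.length + 2 ∨ ((u : ℕ) - (cl.length + 2)) / 2 ^ h = s) → u = s ∨ G.Adj u s := by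
    intro u s hs hu
    by_cases hus : u = s
    · exact .inl hus
    refine .inr ?_
    have hus' : (u : ℕ) ≠ s := fun e => hus (Fin.ext e)
    have hu2 := u.2
    rcases lt_or_gt_of_ne hus' with hlt | hlt
    · rw [hadj' _ _ hlt, mem_allEdges]
      exact .inl ⟨by omega, by omega⟩
    · rw [SimpleGraph.adj_comm, hadj' _ _ hlt, mem_allEdges]
      by_cases hu1 : (u : ℕ) < cl.length + 2
      · rcases lt_or_ge (u : ℕ) 2 with h2 | h2
        · exact .inl ⟨by omega, by omega⟩
        · exact .inr (.inl ⟨hs, h2, hu1⟩)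
      · refine .inr (.inr ⟨u - (cl.length + 2), by omega, by omega, .inl ?_⟩)
        rcases hu with hu | hu
        · omega
        · exact hu.symm
  have hside : ∀ u : Fin (order h cl), ((u : ℕ) - (cl.length + 2)) / 2 ^ h < 2 := fun u =>
    Nat.div_lt_of_lt_mul (by have := u.2; omega)
  let s₀ : Fin (order h cl) := ⟨0, by omega⟩
  let s₁ : Fin (order h cl) := ⟨1, by omega⟩
  have hub' : ∀ u : Fin (order h cl), ∃ s : Fin (order h cl), (s : ℕ) ≤ 1 ∧ (u = s ∨ G.Adj u s) ∧
      ((u : ℕ) < cl.length + 2 ∨ ((u : ℕ) - (cl.length + 2)) / 2 ^ h = s) := fun u => by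
    -- For hubs and clauses the truncated difference is 0, which selects hub 0.
    refine ⟨⟨((u : ℕ) - (cl.length + 2)) / 2 ^ h, by have := hside u; omega⟩, ?_, hub _ _ ?_ ?_, ?_⟩
    · exact Nat.le_of_lt_succ (hside u)
    · exact Nat.le_of_lt_succ (hside u)
    · exact .inr rfl
    · exact .inr rfl
  have reach : ∀ {u v : Fin (order h cl)}, u = v ∨ G.Adj u v → G.Reachable u v := by
    rintro u v (rfl | h)
    exacts [.refl _, h.reachable]
  have hconn : G.Connected := by
    have : ∀ u, G.Reachable u s₀ := fun u => by
      obtain ⟨s, hs, hus, -⟩ := hub' u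
      exact (reach hus).trans (reach (hub s s₀ (by simp [s₀]) (.inl (by omega))))
    exact (SimpleGraph.connected_iff _).2 ⟨fun u v => (this u).trans (this v).symm, ⟨s₀⟩⟩
  refine ⟨G, l, hconn, hl, hmap, ?_, fun hns => SimpleGraph.diam_le_two fun u v => ?_⟩
  · rintro ⟨i, hi, i', hi', hsat⟩
    have hu : cl.length + 2 + i < order h cl := by omega
    have hv : cl.length + 2 + (2 ^ h + i') < order h cl := by omega
    have hi0 : i / 2 ^ h = 0 := Nat.div_eq_of_lt hi
    have hi1 : (2 ^ h + i') / 2 ^ h = 1 := by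
      rw [Nat.add_div_left _ hK, Nat.div_eq_of_lt hi']
    have nbr : ∀ (a : ℕ) (ha : cl.length + 2 + a < order h cl) (x : Fin (order h cl)),
        G.Adj ⟨_, ha⟩ x → (x : ℕ) = a / 2 ^ h ∨
          ∃ j < cl.length, (x : ℕ) = j + 2 ∧ (cl.getD j []).any (litHolds h a) = false := by
      intro a ha x hax
      rw [hadj, mem_allEdges, mem_allEdges] at hax
      -- Edges list the smaller endpoint first, and a half assignment is never the smaller one, so
      -- only the last case survives.
      rcases hax with (hx | hx | ⟨b, hb, hxb, hx⟩) | (hx | hx | ⟨b, hb, hxb, hx⟩)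
      · dsimp only at hx; omega
      · dsimp only at hx; omega
      · have : b / 2 ^ h < 2 := Nat.div_lt_of_lt_mul (by omega)
        rcases hx with hx | ⟨j, hj, hx, -⟩ <;> dsimp only at hx <;> omega
      · dsimp only at hx; omega
      · dsimp only at hx; omega
      · obtain rfl : a = b := by dsimp only at hxb; omega
        exact hx
    refine SimpleGraph.three_le_diam hconn (u := ⟨_, hu⟩) (v := ⟨_, hv⟩) ?_ ?_ ?_
    · intro e
      rw [Fin.mk.injEq] at e
      omega
    · intro e
      rcases nbr _ _ _ e with e | ⟨j, hj, e, -⟩ <;> dsimp only at e <;> omega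
    · rintro x ⟨h1, h2⟩
      rcases nbr _ _ _ h1 with h1 | ⟨j, hj, h1, h1'⟩ <;>
        rcases nbr _ _ _ h2.symm with h2 | ⟨j', hj', h2, h2'⟩
      · omega
      · omega
      · omega
      · obtain rfl : j = j' := by omega
        rcases hsat j hj with h | h
        · rw [h] at h1'; cases h1'
        · rw [h] at h2'; cases h2'
  · obtain ⟨s, hs, hus, hus'⟩ := hub' u
    obtain ⟨t, ht, hvt, hvt'⟩ := hub' v
    have flip : ∀ {x y : Fin (order h cl)}, x = y ∨ G.Adj x y → y = x ∨ G.Adj y x :=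
      fun h => h.imp Eq.symm SimpleGraph.Adj.symm
    -- A hub or a clause is equal or adjacent to both hubs, so the hub of the other vertex serves as
    -- midpoint. Two half assignments with the same hub meet there.
    by_cases hu : (u : ℕ) < cl.length + 2
    · exact ⟨t, hub u t ht (.inl hu), flip hvt⟩
    by_cases hv : (v : ℕ) < cl.length + 2
    · exact ⟨s, hus, flip (hub v s hs (.inl hv))⟩
    by_cases hst : (s : ℕ) = t
    · exact ⟨s, hus, flip (Fin.ext hst ▸ hvt)⟩
    have hu' := hus'.resolve_left hu
    have hv' := hvt'.resolve_left hv
    -- two half assignments of different halves miss a common clause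
    have common : ∀ a b : Fin (order h cl), ¬ (a : ℕ) < cl.length + 2 → ¬ (b : ℕ) < cl.length + 2 →
        ((a : ℕ) - (cl.length + 2)) / 2 ^ h = 0 → ((b : ℕ) - (cl.length + 2)) / 2 ^ h = 1 →
        ∃ x, G.Adj a x ∧ G.Adj x b := by
      intro a b ha hb ha' hb'
      have ha2 := a.2
      have hb2 := b.2
      obtain ⟨i, hi⟩ := Nat.exists_eq_add_of_le (not_lt.1 ha)
      obtain ⟨i', hi'⟩ := Nat.exists_eq_add_of_le (not_lt.1 hb)
      rw [hi, Nat.add_sub_cancel_left] at ha'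
      rw [hi', Nat.add_sub_cancel_left] at hb'
      have hiK : i < 2 ^ h := (Nat.div_eq_zero_iff_lt hK).1 ha'
      have hiK' : 2 ^ h ≤ i' := by
        by_contra hlt
        rw [Nat.div_eq_of_lt (not_le.1 hlt)] at hb'
        cases hb'
      have : ∃ j < cl.length, (cl.getD j []).any (litHolds h i) = false ∧
          (cl.getD j []).any (litHolds h i') = false := by
        by_contra! hno
        refine hns ⟨i, hiK, i' - 2 ^ h, by omega, fun j hj => ?_⟩
        rw [Nat.add_sub_cancel' hiK']
        have := hno j hj
        simp only [ne_eq, Bool.not_eq_false] at this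
        rw [or_iff_not_imp_left, Bool.not_eq_true]
        exact this
      obtain ⟨j, hj, h1, h2⟩ := this
      refine ⟨⟨j + 2, by omega⟩, ?_, ?_⟩
      · rw [SimpleGraph.adj_comm, hadj' _ _ (by dsimp only; omega), mem_allEdges]
        exact .inr (.inr ⟨i, by omega, hi, .inr ⟨j, hj, rfl, h1⟩⟩)
      · rw [hadj' _ _ (by dsimp only; omega), mem_allEdges]
        exact .inr (.inr ⟨i', by omega, hi', .inr ⟨j, hj, rfl, h2⟩⟩)
    rcases (by omega : (s : ℕ) = 0 ∧ (t : ℕ) = 1 ∨ (s : ℕ) = 1 ∧ (t : ℕ) = 0) with ⟨e, e'⟩ | ⟨e, e'⟩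
    · obtain ⟨x, h1, h2⟩ := common u v hu hv (hu'.trans e) (hv'.trans e')
      exact ⟨x, .inr h1, .inr h2⟩
    · obtain ⟨x, h1, h2⟩ := common v u hv hu (hv'.trans e') (hu'.trans e)
      exact ⟨x, .inr h2.symm, .inr h1.symm⟩

end HalfGraph

/-! ### The reduction -/

/-- The clauses of a formula as lists of codes of literals. -/
def CNF.codes {n : ℕ} (F : CNF n) : List (List ℕ) := F.map fun K => K.map Lit.code

theorem CNF.encode_eq {n : ℕ} (F : CNF n) : F.encode = HalfGraph.formulaWords n F.codes := by
  simp [CNF.encode, HalfGraph.formulaWords, HalfGraph.clauseWords, CNF.codes, List.flatMap_map]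

namespace HalfGraph

variable {n h i v : ℕ} {b : Bool}

theorem bool_toNat_inj {a b : Bool} : a.toNat = b.toNat ↔ a = b := by
  cases a <;> cases b <;> decide

theorem litHolds_of_lt (hv : v < 2 * h) (hi : i < 2 ^ h) :
    litHolds h i (2 * v + b.toNat) = true ↔ v < h ∧ i.testBit v = b := by
  have hb := b.toNat_lt
  have e1 : (2 * v + b.toNat) / 2 = v := by omega
  have e2 : (2 * v + b.toNat) % 2 = b.toNat := by omega
  rw [litHolds, decide_eq_true_eq, e1, e2, Nat.div_eq_of_lt hi, Nat.shiftRight_eq_div_pow,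
    ← Nat.toNat_testBit, Nat.div_eq_zero_iff_lt (by omega)]
  refine and_congr_right fun hvh => ?_
  rw [Nat.mod_eq_of_lt hvh]
  exact bool_toNat_inj

theorem litHolds_add (hv : v < 2 * h) (hi : i < 2 ^ h) :
    litHolds h (2 ^ h + i) (2 * v + b.toNat) = true ↔ h ≤ v ∧ i.testBit (v - h) = b := by
  have hb := b.toNat_lt
  have e1 : (2 * v + b.toNat) / 2 = v := by omega
  have e2 : (2 * v + b.toNat) % 2 = b.toNat := by omega
  rw [litHolds, decide_eq_true_eq, e1, e2, Nat.add_div_left _ (by positivity), Nat.div_eq_of_lt hi,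
    Nat.shiftRight_eq_div_pow, ← Nat.toNat_testBit]
  rcases lt_or_ge v h with hvh | hvh
  · rw [Nat.div_eq_of_lt hvh]
    simp [hvh]
  · obtain ⟨u, rfl⟩ := Nat.exists_eq_add_of_le hvh
    have hu : u < h := by omega
    -- Adding `2 ^ h` leaves the bits below position `h` unchanged, and only those are read.
    rw [Nat.add_div_left _ (by omega), Nat.div_eq_of_lt hu, Nat.add_mod_left, Nat.mod_eq_of_lt hu,
      Nat.testBit_two_pow_add_gt hu, Nat.add_sub_cancel_left]
    simp [bool_toNat_inj]

theorem any_litHolds_iff {K : List (Lit n)} {i : ℕ} :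
    (K.map Lit.code).any (litHolds h i) = true ↔
      ∃ x ∈ K, litHolds h i (2 * (x.1 : ℕ) + x.2.toNat) = true := by
  simp [Lit.code]

theorem halvesSatisfy_iff (F : CNF n) (hn : n ≤ 2 * h) :
    HalvesSatisfy h F.codes ↔ F.Satisfiable := by
  have key : ∀ P : List ℕ → Prop, (∀ j < F.codes.length, P (F.codes.getD j [])) ↔
      ∀ K ∈ F, P (K.map Lit.code) := by
    intro P
    have : (∀ j < F.codes.length, P (F.codes.getD j [])) ↔ ∀ K ∈ F.codes, P K := by
      constructor
      · intro hP K hK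
        obtain ⟨j, hj, rfl⟩ := List.getElem_of_mem hK
        have := hP j hj
        rwa [List.getD_eq_getElem _ _ hj] at this
      · intro hP j hj
        rw [List.getD_eq_getElem _ _ hj]
        exact hP _ (List.getElem_mem hj)
    rw [this, CNF.codes, List.forall_mem_map]
  constructor
  · rintro ⟨i, hi, i', hi', hsat⟩
    have hsat' := (key fun K => K.any (litHolds h i) = true ∨
      K.any (litHolds h (2 ^ h + i')) = true).1 hsat
    refine ⟨fun v => if (v : ℕ) < h then i.testBit v else i'.testBit (v - h), fun K hK => ?_⟩
    rcases hsat' K hK with hx | hx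
    · obtain ⟨x, hx, hx'⟩ := any_litHolds_iff.1 hx
      obtain ⟨h1, h2⟩ := (litHolds_of_lt (x.1.2.trans_le hn) hi).1 hx'
      exact ⟨x, hx, (if_pos h1).trans h2⟩
    · obtain ⟨x, hx, hx'⟩ := any_litHolds_iff.1 hx
      obtain ⟨h1, h2⟩ := (litHolds_add (x.1.2.trans_le hn) hi').1 hx'
      exact ⟨x, hx, (if_neg (not_lt.2 h1)).trans h2⟩
  · rintro ⟨a, ha⟩
    -- The two halves may have more positions than there are variables, as for odd `n`; the surplus
    -- gets `false`.
    let f : ℕ → Bool := fun v => if hv : v < n then a ⟨v, hv⟩ else false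
    have hf : ∀ v : Fin n, f v = a v := fun v => dif_pos v.2
    have b1 := Nat.ofBits_lt_two_pow fun v : Fin h => f v
    have b2 := Nat.ofBits_lt_two_pow fun v : Fin h => f (v + h)
    refine ⟨_, b1, _, b2, (key fun K => K.any (litHolds h _) = true ∨
      K.any (litHolds h (2 ^ h + _)) = true).2 fun K hK => ?_⟩
    obtain ⟨x, hx, hax⟩ := ha K hK
    have hxn := x.1.2
    rcases lt_or_ge (x.1 : ℕ) h with hxh | hxh
    · refine .inl (any_litHolds_iff.2 ⟨x, hx, (litHolds_of_lt (by omega) b1).2 ⟨hxh, ?_⟩⟩)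
      rw [Nat.testBit_ofBits_lt _ _ hxh, hf, hax]
    · refine .inr (any_litHolds_iff.2 ⟨x, hx, (litHolds_add (by omega) b2).2 ⟨hxh, ?_⟩⟩)
      rw [Nat.testBit_ofBits_lt _ _ (by omega)]
      dsimp only
      rw [Nat.sub_add_cancel hxh, hf, hax]

theorem lt_of_mem_formulaWords {F : CNF n} {x w : ℕ} (hn : 2 * n < 2 ^ w)
    (hw : (formulaWords n F.codes).length < 2 ^ w) (hx : x ∈ formulaWords n F.codes) :
    x < 2 ^ w := by
  have hlen := length_le_length_formulaWords (cl := F.codes) (n := n)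
  rcases List.mem_cons.1 hx with rfl | hx
  · omega
  rcases List.mem_cons.1 hx with rfl | hx
  · omega
  obtain ⟨K, hK, hx⟩ := List.mem_flatMap.1 hx
  rcases List.mem_cons.1 hx with rfl | hx
  · obtain ⟨j, hj, rfl⟩ := List.getElem_of_mem hK
    have := clausePos_add_le (n := n) hj
    rw [List.getD_eq_getElem _ _ hj] at this
    omega
  · obtain ⟨K', -, rfl⟩ := List.mem_map.1 hK
    obtain ⟨⟨v, b⟩, -, rfl⟩ := List.mem_map.1 hx
    have hv := v.2
    have hb := b.toNat_lt
    simp only [Lit.code]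
    omega

/-! ### Word length and running time of the reduction -/

theorem sizeBound_le (n : ℕ) (cl : List (List ℕ)) :
    sizeBound n cl ≤ 4 * (formulaWords n cl).length * 2 ^ ((n + 1) / 2) := by
  have hlen := length_le_length_formulaWords (cl := cl) (n := n)
  have hK : 1 ≤ 2 ^ ((n + 1) / 2) := Nat.one_le_two_pow
  rw [sizeBound]
  generalize 2 ^ ((n + 1) / 2) = K at *
  nlinarith

theorem length_allEdges_le_sizeBound (n : ℕ) (cl : List (List ℕ)) :
    (allEdges ((n + 1) / 2) cl).length ≤ sizeBound n cl := length_allEdges_le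

/-- The word length that the reduction needs. -/
theorem word_bounds (n c : ℕ) (cl : List (List ℕ)) :
    let B := (formulaWords n cl).length
    let w := (2 * c + 8) * (n + Nat.size B)
    2 * n < 2 ^ w ∧ n + 1 < 2 ^ w ∧ B + 3 * sizeBound n cl + 10 < 2 ^ w ∧
      B + 2 ^ (c * Nat.size (allEdges ((n + 1) / 2) cl).length) ≤ 2 ^ w := by
  intro B w
  have hlen : cl.length + 2 ≤ B := length_le_length_formulaWords
  set z := Nat.size B with hz
  have hBz : B < 2 ^ z := Nat.lt_size_self B
  have hz2 : 2 ≤ z := Nat.lt_size.2 (by omega)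
  set y := n + z with hy
  have hBy : B < 2 ^ y := hBz.trans_le (Nat.pow_le_pow_right (by omega) (by omega))
  have hny : n + 1 ≤ 2 ^ y := by
    have : n < 2 ^ n := Nat.lt_two_pow_self
    have : 2 ^ n ≤ 2 ^ y := Nat.pow_le_pow_right (by omega) (by omega)
    omega
  have hS : sizeBound n cl < 4 * 2 ^ y := by
    refine (sizeBound_le n cl).trans_lt ?_
    have h1 : 2 ^ ((n + 1) / 2) ≤ 2 ^ n := Nat.pow_le_pow_right (by omega) (by omega)
    have h2 : B * 2 ^ ((n + 1) / 2) < 2 ^ z * 2 ^ n :=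
      Nat.mul_lt_mul_of_lt_of_le hBz h1 (by positivity)
    rw [hy, Nat.add_comm n z, pow_add, Nat.mul_assoc]
    exact Nat.mul_lt_mul_of_pos_left h2 (by norm_num)
  -- The number of edges has at most `y + 2` bits, and `2 ≤ y`; this is the origin of the factor `2
  -- * c` in the word length.
  have hM : Nat.size (allEdges ((n + 1) / 2) cl).length ≤ 2 * y := by
    rw [Nat.size_le]
    refine (length_allEdges_le_sizeBound n cl).trans_lt (hS.trans_le ?_)
    rw [show 4 * 2 ^ y = 2 ^ (y + 2) by ring]
    exact Nat.pow_le_pow_right (by omega) (by omega)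
  have hy4 : 4 ≤ 2 ^ y := by
    calc 4 = 2 ^ 2 := rfl
      _ ≤ 2 ^ y := Nat.pow_le_pow_right (by omega) (by omega)
  have hw : w = 2 * c * y + 8 * y := by simp only [w]; ring
  -- `B + 3 * sizeBound n cl + 10` is below `13 * 2 ^ y + 10`, and `10 ≤ 3 * 2 ^ y` by `hy4`.
  have hw1 : 16 * 2 ^ y ≤ 2 ^ w := by
    rw [show 16 * 2 ^ y = 2 ^ (y + 4) by ring, hw]
    refine Nat.pow_le_pow_right (by omega) ?_
    have := Nat.zero_le (2 * c * y)
    omega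
  refine ⟨by omega, by omega, by omega, ?_⟩
  have h3 : 2 ^ (c * Nat.size (allEdges ((n + 1) / 2) cl).length) ≤ 2 ^ (2 * c * y) := by
    refine Nat.pow_le_pow_right (by omega) ?_
    calc c * _ ≤ c * (2 * y) := Nat.mul_le_mul_left _ hM
      _ = 2 * c * y := by ring
  have h4 : 2 ^ y ≤ 2 ^ (2 * c * y + y) := Nat.pow_le_pow_right (by omega) (by omega)
  have h5 : 2 ^ (2 * c * y) ≤ 2 ^ (2 * c * y + y) := Nat.pow_le_pow_right (by omega) (by omega)
  have h6 : 2 * 2 ^ (2 * c * y + y) ≤ 2 ^ w := by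
    rw [← pow_succ', hw]
    exact Nat.pow_le_pow_right (by omega) (by omega)
  omega

theorem time_bound {ε : ℝ} (hε : 0 < ε) (hε' : ε ≤ 1 / 2) (n C : ℕ) (cl : List (List ℕ)) :
    (sizeBound n cl * ((formulaWords n cl).length * 15 + 60) + 2 *
      (C * ((allEdges ((n + 1) / 2) cl).length : ℝ) ^ (2 - ε)) + 5 : ℝ) ≤
      (365 + 64 * C : ℕ) * ((2 : ℝ) ^ (1 - ε / 2)) ^ n *
        ((n + (formulaWords n cl).length : ℕ) : ℝ) ^ 2 := by
  have hlen := length_le_length_formulaWords (cl := cl) (n := n)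
  have hS : (sizeBound n cl : ℝ) ≤ 4 * (formulaWords n cl).length * 2 ^ ((n + 1) / 2) := by
    exact_mod_cast sizeBound_le n cl
  have hM : ((allEdges ((n + 1) / 2) cl).length : ℝ) ≤ sizeBound n cl := by
    exact_mod_cast length_allEdges_le_sizeBound n cl
  have hB : (2 : ℝ) ≤ (formulaWords n cl).length := by
    exact_mod_cast (by omega : 2 ≤ (formulaWords n cl).length)
  have hM0 : (0 : ℝ) ≤ (allEdges ((n + 1) / 2) cl).length := Nat.cast_nonneg _
  set B : ℝ := ((formulaWords n cl).length : ℝ)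
  set S : ℝ := (sizeBound n cl : ℝ)
  set M : ℝ := ((allEdges ((n + 1) / 2) cl).length : ℝ)
  set β : ℝ := (2 : ℝ) ^ (1 - ε / 2) with hβ
  have hβ1 : 1 ≤ β := Real.one_le_rpow (by norm_num) (by linarith)
  have hβ2 : β ≤ 2 := by
    calc β ≤ (2 : ℝ) ^ (1 : ℝ) := Real.rpow_le_rpow_of_exponent_le (by norm_num) (by linarith)
      _ = 2 := Real.rpow_one 2
  have hβn : 1 ≤ β ^ n := one_le_pow₀ hβ1
  have hβn1 : β ^ (n + 1) ≤ 2 * β ^ n := by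
    rw [pow_succ']
    exact mul_le_mul_of_nonneg_right hβ2 (by positivity)
  have hK : ((2 : ℝ) ^ ((n + 1) / 2)) ≤ (2 : ℝ) ^ (((n : ℝ) + 1) / 2) := by
    rw [← Real.rpow_natCast]
    refine Real.rpow_le_rpow_of_exponent_le (by norm_num) ?_
    have := Nat.cast_div_le (α := ℝ) (m := n + 1) (n := 2)
    simpa using this
  have hβpow : β ^ (n + 1) = (2 : ℝ) ^ ((1 - ε / 2) * ((n : ℝ) + 1)) := by
    rw [Real.rpow_mul (by norm_num), ← hβ, ← Real.rpow_natCast]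
    push_cast
    rfl
  have hKβ : ((2 : ℝ) ^ ((n + 1) / 2)) ≤ β ^ (n + 1) := by
    refine hK.trans ?_
    rw [hβpow]
    refine Real.rpow_le_rpow_of_exponent_le (by norm_num) ?_
    have : (0 : ℝ) ≤ n := Nat.cast_nonneg n
    nlinarith
  -- The heart of the estimate: (2 - ε)(n + 1)/2 = (1 - ε/2)(n + 1), so a subquadratic algorithm on
  -- about 2^(n/2) edges beats 2^n.
  have hKβ' : ((2 : ℝ) ^ ((n + 1) / 2)) ^ (2 - ε) ≤ β ^ (n + 1) := by
    refine (Real.rpow_le_rpow (by positivity) hK (by linarith)).trans_eq ?_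
    rw [hβpow, ← Real.rpow_mul (by norm_num)]
    congr 1
    ring
  -- Since B ≥ 2, the second factor is at most 45·B, and 360 = 8·45.
  have h1 : S * (B * 15 + 60) ≤ 360 * (β ^ n * B ^ 2) := by
    have hS' : S ≤ 8 * B * β ^ n := by
      calc S ≤ 4 * B * 2 ^ ((n + 1) / 2) := hS
        _ ≤ 4 * B * (2 * β ^ n) :=
          mul_le_mul_of_nonneg_left (hKβ.trans hβn1) (by positivity)
        _ = 8 * B * β ^ n := by ring
    calc S * (B * 15 + 60) ≤ (8 * B * β ^ n) * (45 * B) :=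
          mul_le_mul hS' (by linarith) (by positivity) (by positivity)
      _ = 360 * (β ^ n * B ^ 2) := by ring
  have h2 : M ^ (2 - ε) ≤ 32 * (β ^ n * B ^ 2) := by
    calc M ^ (2 - ε) ≤ (4 * B * 2 ^ ((n + 1) / 2)) ^ (2 - ε) :=
          Real.rpow_le_rpow hM0 (hM.trans hS) (by linarith)
      _ = (4 * B) ^ (2 - ε) * ((2 : ℝ) ^ ((n + 1) / 2)) ^ (2 - ε) :=
          Real.mul_rpow (by positivity) (by positivity)
      _ ≤ (4 * B) ^ (2 : ℝ) * (2 * β ^ n) :=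
          mul_le_mul (Real.rpow_le_rpow_of_exponent_le (by linarith) (by linarith))
            (hKβ'.trans hβn1) (by positivity) (by positivity)
      _ = 32 * (β ^ n * B ^ 2) := by
          rw [Real.rpow_two]
          ring
  have h3 : 1 ≤ β ^ n * B ^ 2 := one_le_mul_of_one_le_of_one_le hβn (by nlinarith)
  have h4 : β ^ n * B ^ 2 ≤ β ^ n * ((n : ℝ) + B) ^ 2 := by
    have : (0 : ℝ) ≤ n := Nat.cast_nonneg n
    gcongr
    linarith
  have h5 : (C : ℝ) * M ^ (2 - ε) ≤ C * (32 * (β ^ n * B ^ 2)) :=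
    mul_le_mul_of_nonneg_left h2 (Nat.cast_nonneg C)
  push_cast
  calc S * (B * 15 + 60) + 2 * (C * M ^ (2 - ε)) + 5
      ≤ 360 * (β ^ n * B ^ 2) + 2 * (C * (32 * (β ^ n * B ^ 2))) + 5 * (β ^ n * B ^ 2) := by
        linarith
    _ = (365 + 64 * C) * (β ^ n * B ^ 2) := by ring
    _ ≤ (365 + 64 * C) * (β ^ n * ((n : ℝ) + B) ^ 2) :=
        mul_le_mul_of_nonneg_left h4 (by positivity)
    _ = (365 + 64 * C) * β ^ n * ((n : ℝ) + B) ^ 2 := by ring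

end HalfGraph

/-! ### From the diameter to satisfiability and SETH -/

theorem RAM.Program.Outputs.mono_time {P : RAM.Program} {x : List ℕ} {y w : ℕ} {T T' : ℝ}
    (h : P.Outputs x y T w) (hT : T ≤ T') : P.Outputs x y T' w := by
  obtain ⟨t, ht, h'⟩ := h
  exact ⟨t, ht.trans hT, h'⟩

theorem RAM.Program.Outputs.congr_result {P : RAM.Program} {x : List ℕ} {y y' w : ℕ} {T : ℝ}
    (h : P.Outputs x y T w) (hy : y = y') : P.Outputs x y' T w := hy ▸ h

open HalfGraph in
theorem DiameterApproxInTime.cnfSatInTime {ε : ℝ} (hε : 0 < ε) (hε' : ε ≤ 1 / 2)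
    (h : DiameterApproxInTime (3 / 2 - ε) (fun m => (m : ℝ) ^ (2 - ε))) :
    CnfSatInTime (2 ^ (1 - ε / 2)) := by
  obtain ⟨Q, C, c, hQ⟩ := h
  refine ⟨satProgram Q, 365 + 64 * C, 2, 2 * c + 8, fun n F _ => ?_⟩
  obtain ⟨G, l, hconn, hl, hmap, hsat, hunsat⟩ := exists_graph ((n + 1) / 2) F.codes
  rw [halvesSatisfy_iff F (by omega)] at hsat hunsat
  have hlen : l.length = (allEdges ((n + 1) / 2) F.codes).length := by
    rw [← hmap, List.length_map]
  -- The edge between the hubs guarantees at least one edge, even for the empty formula.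
  obtain ⟨E, hE, hlow, hup⟩ := hQ _ G l hconn hl (by rw [hlen]; simp [allEdges])
  have henc : encodeGraph _ l = order ((n + 1) / 2) F.codes ::
      (allEdges ((n + 1) / 2) F.codes).length :: edgeWords (allEdges ((n + 1) / 2) F.codes) := by
    rw [encodeGraph, hlen, edgeWords, ← hmap, List.flatMap_map]
  rw [henc, hlen] at hE
  have hiff : 2 < E ↔ F.Satisfiable := by
    constructor
    · intro hE2
      by_contra hF
      have := hunsat hF
      omega
    · intro hF
      have hD : (3 : ℝ) ≤ G.diam := by exact_mod_cast hsat hF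
      rw [div_le_iff₀ (by linarith)] at hlow
      by_contra hE2
      have hE2' : (E : ℝ) ≤ 2 := by exact_mod_cast not_lt.1 hE2
      -- If E ≤ 2, then D ≤ E(3/2 - ε) ≤ 3 - 2ε < 3, a contradiction.
      nlinarith
  obtain ⟨b1, b2, b3, b4⟩ := word_bounds n c F.codes
  have hout := satProgram_outputs hE b2
    (fun x hx => lt_of_mem_formulaWords b1 (by omega) hx) b3 b4
  rw [CNF.encode_eq]
  refine (hout.mono_time (time_bound hε hε' n C F.codes)).congr_result ?_
  by_cases hF : F.Satisfiable
  · rw [if_pos hF, if_pos (hiff.2 hF)]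
  · rw [if_neg hF, if_neg (mt hiff.1 hF)]

theorem mainTheorem2 (ε : ℝ) (hε : 0 < ε) (hε' : ε ≤ 1 / 2)
    (h : DiameterApproxInTime (3 / 2 - ε) (fun m => (m : ℝ) ^ (2 - ε))) :
    (∃ δ : ℝ, 0 < δ ∧ δ < 1 ∧ CnfSatInTime (2 - δ)) ∧ ¬ SETH := by
  have hcnf := h.cnfSatInTime hε hε'
  refine ⟨⟨2 - 2 ^ (1 - ε / 2), ?_, ?_, ?_⟩, fun hseth => ?_⟩
  · have := Real.rpow_lt_rpow_of_exponent_lt (x := 2) (by norm_num) (by linarith : 1 - ε / 2 < 1)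
    rw [Real.rpow_one] at this
    linarith
  · have := Real.one_lt_rpow (x := 2) (by norm_num) (by linarith : 0 < 1 - ε / 2)
    linarith
  · rwa [sub_sub_cancel]
  -- One program serves all clause widths, so the bound is uniform in `r` and passes to the limit.
  · have hle : ∀ r, satExponent r ≤ 1 - ε / 2 := by
      intro r
      obtain ⟨P, C, k, c, hP⟩ := hcnf
      exact csInf_le ⟨0, fun _ hx => hx.1⟩
        ⟨by linarith, P, C, k, c, fun n F _ => hP n F trivial⟩
    have := le_of_tendsto' hseth hle
    linarith
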